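/- \textbf{Notation.} For $l\in\mathbb N$, $a\in\mathbb C$ let $d(l,a)$ be the functional $f\mapsto f^{(l)}(a)$, let $\mathcal C$ be the complex vector space with basis the $d(l,a)$, and let $\mathcal C(a)\subset\mathcal C$ be spanned by the $d(l,a)$, $l\ge 0$. Let $Gr_1^*$ be the set of pairs $(C,q)$ of a finite dimensional subspace $C\subset\mathcal C$ and a monic $q\in\mathbb C[z]$ of degree $\dim C$. The subspace $W$ attached to $(C,q)$ is the closure of $q^{-1}V_C$, $V_C=\{f\in\mathbb C[z]: c(f)=0\ \forall c\in C\}$, in $L^2$ of a circle $|z|=R$ with $R$ sufficiently large. For a basis $(c_i)_{1\le i\le M}$ of $C$ put $$\tau(x,t_2)=\prod_{q(\lambda)=0}e^{-(\lambda x+\lambda^2t_2)}\;\det\bigl(c_i(z^{j}e^{xz+t_2z^2})\bigr)_{1\le i\le M,\;0\le j\le M-1}$$ (zeros $\lambda$ of $q$ with multiplicity; $\tau$ is defined up to a nonzero constant). The stationary wave function $\psi(x,z)$ of $(C,q)$ is, for each $x$ with $\tau(x,0)\neq0$, the unique function of the form $(1+\alpha_1(x)z^{-1}+\alpha_2(x)z^{-2}+\cdots)e^{xz}$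 for $|z|$ large that lies in $W$, continued analytically in $z$ to the complement of the zeros of $q$. A \emph{bispectral rational KP solution} is a point $W^*=(C,q)\in Gr_1^*$ such that $C$ has a basis $c_1,\dots,c_M$ with $c_i\in\mathcal C(\lambda_i)$ for some (not necessarily distinct) $\lambda_i\in\mathbb C$, and $q(z)=\prod_{i=1}^M(z-\lambda_i)$. Its particle system $(\vec x,\vec y)$, $\vec x,\vec y\in\mathbb C^n$, consists of the zeros $x_i$ of the polynomial $\tau(\cdot,0)$, counted with multiplicity, and of $y_i=\frac12\frac{d}{dt_2}x_i(t_2)\big|_{t_2=0}$, where $x_1(t_2),\dots,x_n(t_2)$ are the zeros of $\tau(\cdot,t_2)$ with $x_i(0)=x_i$. A point of $Gr_1^*$ is the image $\beta(W^*)$ of $W^*$ under the bispectral involution if its stationary wave function is $\psi(z,x)$, where $\psi(x,z)$ is the stationary wave function of $W^*$. \textbf{Theorem.} Let $W^*\in Gr_1^*$ be a bispectral rational KP solution with particle system $(\vec x,\vec y)$ whose positions $x_1,\dots,x_n$ are distinct. Then the conditions $$c_i(f)=f'(x_i)+\Bigl(y_i-\sum_{j\ne i}\frac1{x_i-x_j}\Bigr)f(x_i),\qquad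 1\le i\le n,$$ are linearly independent, and their span $C'$ together with $q'(z)=\prod_{i=1}^n(z-x_i)$ is the point $\beta(W^*)=(C',q')$ of $Gr_1^*$. -/

import Mathlib

open Polynomial Filter Topology MeasureTheory

noncomputable section

/-- The complex vector space `𝒞` generated by the symbols `d(l, a)`, `l ∈ ℕ`, `a ∈ ℂ`;
`d(l, a)` acts on functions by `f ↦ f⁽ˡ⁾(a)`. -/
abbrev Cond : Type := (ℕ × ℂ) →₀ ℂ

/-- The condition `d(l, a)`. -/
def Cond.d (l : ℕ) (a : ℂ) : Cond := Finsupp.single (l, a) 1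

/-- The value `c(f)` of a condition on a function of `z`. -/
def Cond.app (c : Cond) (f : ℂ → ℂ) : ℂ := c.sum fun p k => k * iteratedDeriv p.1 f p.2

/-- The subspace `𝒞(a)` of the conditions that involve only the point `a`. -/
def Cond.at (a : ℂ) : Submodule ℂ Cond := Submodule.span ℂ (Set.range fun l : ℕ => Cond.d l a)

/-- A point `(C, q)` of the dual grassmannian `Gr₁*`: a finite dimensional space `C` of conditions
(the field `space`) and a monic polynomial whose degree is `dim C`. -/
structure Gr1Star where
  space : Submodule ℂ Cond
  finite : FiniteDimensional ℂ space
  q : ℂ[X]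
  monic : q.Monic
  natDegree_eq : q.natDegree = Module.finrank ℂ space

namespace Gr1Star

instance (P : Gr1Star) : FiniteDimensional ℂ P.space := P.finite

instance (P : Gr1Star) : Module.Free ℂ P.space := Module.Free.of_divisionRing ℂ P.space

/-- `dim C`. -/
abbrev dim (P : Gr1Star) : ℕ := Module.finrank ℂ P.space

/-- `V_C`: the polynomials that satisfy every condition of `C`. -/
def V (P : Gr1Star) : Submodule ℂ ℂ[X] where
  carrier := {f | ∀ c ∈ P.space, c.app (fun z => f.eval z) = 0}
  add_mem' := by
    intro f g hf hg c hc
    have h : c.app (fun z => (f + g).eval z)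
        = c.app (fun z => f.eval z) + c.app (fun z => g.eval z) := by
      simp only [Cond.app, Finsupp.sum, eval_add]
      rw [← Finset.sum_add_distrib]
      refine Finset.sum_congr rfl fun p _ => ?_
      have e := iteratedDeriv_fun_add (n := p.1) (x := p.2)
        (f := fun z : ℂ => f.eval z) (g := fun z : ℂ => g.eval z)
        (f.contDiff_aeval (𝕜 := ℂ) p.1).contDiffAt (g.contDiff_aeval (𝕜 := ℂ) p.1).contDiffAt
      rw [e, mul_add]
    rw [h, hf c hc, hg c hc, add_zero]
  zero_mem' := by
    intro c _
    simp only [Cond.app, Finsupp.sum, eval_zero]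
    refine Finset.sum_eq_zero fun p _ => ?_
    simp
  smul_mem' := by
    intro a f hf c hc
    have h : c.app (fun z => (a • f).eval z) = a * c.app (fun z => f.eval z) := by
      simp only [Cond.app, Finsupp.sum, eval_smul, smul_eq_mul]
      rw [Finset.mul_sum]
      refine Finset.sum_congr rfl fun p _ => ?_
      have e := iteratedDeriv_const_mul_field (n := p.1) (x := p.2) a (fun z : ℂ => f.eval z)
      rw [e]; ring
    rw [h, hf c hc, mul_zero]

end Gr1Star

/-- The Hilbert space `H = L²(S¹)`, spanned by the integer powers of `z = e^{2πiθ}`. -/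
abbrev CircleL2 : Type := Lp ℂ 2 (AddCircle.haarAddCircle : Measure UnitAddCircle)

/-- The restriction of a function of `z` to the circle `|z| = R`, as a function on the unit
circle. -/
def onCircle (R : ℝ) (g : ℂ → ℂ) (θ : UnitAddCircle) : ℂ :=
  g ((R : ℂ) * (AddCircle.toCircle θ : ℂ))

namespace Gr1Star

/-- The elements of `q⁻¹ V_C`, restricted to the circle `|z| = R`. -/
def preimageSpace (P : Gr1Star) (R : ℝ) : Submodule ℂ CircleL2 where
  carrier := {h | ∃ f ∈ P.V, (h : UnitAddCircle → ℂ) =ᵐ[AddCircle.haarAddCircle]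
    onCircle R fun z => f.eval z / P.q.eval z}
  add_mem' := by
    rintro g h ⟨f₁, hf₁, h₁⟩ ⟨f₂, hf₂, h₂⟩
    refine ⟨f₁ + f₂, P.V.add_mem hf₁ hf₂, ?_⟩
    filter_upwards [Lp.coeFn_add g h, h₁, h₂] with θ e e₁ e₂
    rw [e, Pi.add_apply, e₁, e₂]
    simp [onCircle, add_div]
  zero_mem' := by
    refine ⟨0, P.V.zero_mem, ?_⟩
    filter_upwards [Lp.coeFn_zero ℂ 2 (AddCircle.haarAddCircle : Measure UnitAddCircle)]
      with θ e
    rw [e]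
    simp [onCircle]
  smul_mem' := by
    rintro a h ⟨f, hf, h₁⟩
    refine ⟨a • f, P.V.smul_mem a hf, ?_⟩
    filter_upwards [Lp.coeFn_smul a h, h₁] with θ e e₁
    rw [e, Pi.smul_apply, e₁]
    simp [onCircle, mul_div_assoc]

/-- The dual mapping: the space `W` attached to `(C, q)`, i.e. the Hilbert closure of `q⁻¹ V_C`,
formed on the circle `|z| = R` (which amounts to a rescaling of `z`). It is used for large `R`
only, when the circle encloses the zeros of `q` and the points that occur in `C`. -/
def W (P : Gr1Star) (R : ℝ) : Submodule ℂ CircleL2 := (P.preimageSpace R).topologicalClosure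

/-- The tau function of `(C, q)` in the variables `s = x = t₁` and `t = t₂`: the determinant of
`c_i (z ^ j e^{sz + tz²})` over a basis of `C`, which belongs to the gauge `z ^ dim C`, times the
factor `∏ e^{-(l s + l² t)}` over the zeros `l` of `q`, which passes to the gauge `q`.
A change of basis multiplies it by a nonzero constant. -/
def tau (P : Gr1Star) (s t : ℂ) : ℂ :=
  (P.q.roots.map fun l => Complex.exp (-(l * s + l ^ 2 * t))).prod *
    Matrix.det (Matrix.of fun i j : Fin P.dim =>
      Cond.app (Module.finBasis ℂ P.space i : Cond)
        fun z => z ^ (j : ℕ) * Complex.exp (s * z + t * z ^ 2))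

/-- `ψ` is the stationary wave function of the point `W` attached to `(C, q)`: for every `x` in
its domain (the complement of the zeros of `tau`) it has the form
`(1 + α₁(x) z⁻¹ + α₂(x) z⁻² + ⋯) e^{xz}` for large `z`, and lies in `W`. As a function of `z` it
is continued analytically to the complement of the zeros of `q`. -/
def IsStationaryWave (P : Gr1Star) (ψ : ℂ → ℂ → ℂ) : Prop :=
  ∀ x : ℂ, P.tau x 0 ≠ 0 →
    DifferentiableOn ℂ (ψ x) {z | P.q.eval z ≠ 0} ∧
    (∃ α : ℕ → ℂ, ∀ᶠ z in Bornology.cobounded ℂ,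
      HasSum (fun k : ℕ => α (k + 1) * (z ^ (k + 1))⁻¹)
        (ψ x z * Complex.exp (-(x * z)) - 1)) ∧
    ∀ᶠ R : ℝ in atTop, ∃ h ∈ P.W R,
      (h : UnitAddCircle → ℂ) =ᵐ[AddCircle.haarAddCircle] onCircle R (ψ x)

/-- `(C, q)` is a rational solution in the bispectral gauge: `C` has a basis of conditions
`c_i ∈ 𝒞(l_i)`, and `q = ∏ (z - l_i)`. The points `l_i` may coincide. -/
def IsBispectralRational (P : Gr1Star) : Prop :=
  ∃ (l : Fin P.dim → ℂ) (b : Module.Basis (Fin P.dim) ℂ P.space),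
    (∀ i, (b i : Cond) ∈ Cond.at (l i)) ∧ P.q = ∏ i, (X - C (l i))

/-- `(x, y)` is the particle system of `(C, q)`: the positions `x_i` are the zeros (with
multiplicity) of the polynomial `tau` in `x` at time `t₂ = 0`, and `y_i` is one half of the
velocity at `t₂ = 0` with which the zero that starts at `x_i` moves under the flow of `t₂`. -/
def IsParticleSystem (P : Gr1Star) {n : ℕ} (x y : Fin n → ℂ) : Prop :=
  ∃ ξ : Fin n → ℂ → ℂ,
    (∀ i, ξ i 0 = x i) ∧ (∀ i, HasDerivAt (ξ i) (2 * y i) 0) ∧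
    ∀ᶠ t in 𝓝 (0 : ℂ), ∃ k : ℂ, k ≠ 0 ∧ ∀ s : ℂ, P.tau s t = k * ∏ i, (s - ξ i t)

/-- `Q` is the image `β(P)` of `P` under the bispectral involution: the stationary wave function
of `Q` is the one of `P` with the two variables exchanged, `ψ_Q(x, z) = ψ_P(z, x)`. -/
def IsBispectralImage (P Q : Gr1Star) : Prop :=
  ∃ ψ : ℂ → ℂ → ℂ, P.IsStationaryWave ψ ∧ Q.IsStationaryWave fun x z => ψ z x

end Gr1Star

/-- The conditions `c_i(f) = f'(x_i) + (y_i - ∑_{j ≠ i} 1 / (x_i - x_j)) f(x_i)`. -/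
def dualCond {n : ℕ} (x y : Fin n → ℂ) (i : Fin n) : Cond :=
  Cond.d 1 (x i) + (y i - ∑ j ∈ Finset.univ.erase i, 1 / (x i - x j)) • Cond.d 0 (x i)

end

/-!
Let `cᵢ ∈ 𝒞(lᵢ)`, `1 ≤ i ≤ M`, be the given basis of `C`. Applied to `e^{xz}` they give functions
`e^{lᵢx} pᵢ(x)` with polynomials `pᵢ`. Let `D` be the Wronskian of these functions without its
exponential factor (`twistMatrix`), and let `D ∂ᴹ - ∑ Nⱼ ∂ʲ` be the differential operator with
polynomial coefficients that annihilates them (`waveCoeff`). Then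
`B(x, z) = D(x) zᴹ - ∑ Nⱼ(x) zʲ` (`waveNum`) is the numerator of the stationary wave function
`ψ = B e^{xz} / (q(z) D(x))`, and `D` is the tau function at `t₂ = 0` up to a constant. The theorem
follows from three facts about `B`.

* A function `g(z)e^{xz} / q(z)`, with `g` monic of degree `dim C` and `g(z)e^{xz}` satisfying the
  conditions of `C`, is the stationary wave function at `x` (`Gr1Star.wave_of_monic`). It lies in
  `W` since an entire function with the conditions of `C` is a limit of polynomials with these
  conditions.

* The pole condition (`waveNum_pole_condition`). Differentiation of `D` in `x` and `t₂` shifts the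
  columns of the determinant by one and two places, which expresses the two leading coefficients of
  `B` by `D`, its derivatives and the velocity of its zeros. At a simple zero `xᵢ` of `D`, both
  `B e^{xz}` and its `x`-derivative, divided by `e^{xz}`, are polynomials in `z` of degree less
  than `M` that satisfy the same `M` conditions, and the first `M - 1` powers of `z` are independent
  for these conditions because the zero is simple. So the two polynomials are proportional, and
  comparison of the leading coefficients gives the conditions of `C'` for `x ↦ B(x, z)e^{xz}`. This is the
  classical fact that the poles of a solution of `ψ_t = ψ_xx + uψ`, `u = 2 (log τ)_xx`, determine
  the regular part of `ψ` by their velocities.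

* `B(x, z)` has degree `n = deg D` in `x`, with top coefficient a constant times `q(z)`
  (`natDegree_waveNum_le_and_coeff`). The polynomials `pᵢ` with `lᵢ = a` are solutions of a linear
  differential equation whose coefficients are the Taylor coefficients of `B` in `z` at `a`. Their
  span contains polynomials of as many degrees as its dimension `m`, all of them roots of the
  indicial polynomial at infinity, so some Taylor coefficient of index at least `m` enters the
  indicial polynomial, and the first `m` of them have too small a degree in `x` to contribute to the
  top coefficient (`Polynomial.coeff_eq_zero_of_sum_mul_iterate_derivative`). Thus the top
  coefficient vanishes to order `m` at `a`.

By the last two facts `x ↦ B(x, z) / (constant · q(z))` is monic of degree `n` and satisfies the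
conditions of `C'` after multiplication with `e^{xz}`. So the first fact, applied to `(C', q')`,
gives the result.
-/

/-! ### Conditions applied to `z ^ j e^{sz + tz²}` -/

namespace Cond

/-- The pairing of conditions with a fixed function, as a linear functional on `𝒞`. -/
noncomputable def appLin (f : ℂ → ℂ) : Cond →ₗ[ℂ] ℂ :=
  Finsupp.linearCombination ℂ fun p : ℕ × ℂ => iteratedDeriv p.1 f p.2

theorem appLin_apply (f : ℂ → ℂ) (c : Cond) : appLin f c = c.app f := rfl

theorem app_congr {f g : ℂ → ℂ} (h : ∀ z, f z = g z) (c : Cond) : c.app f = c.app g := by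
  rw [funext h]

theorem app_sum {ι : Type*} (s : Finset ι) (F : ι → ℂ → ℂ) (hF : ∀ i ∈ s, ContDiff ℂ ⊤ (F i))
    (c : Cond) : c.app (fun z => ∑ i ∈ s, F i z) = ∑ i ∈ s, c.app (F i) := by
  simp only [app, Finsupp.sum]
  rw [Finset.sum_comm]
  refine Finset.sum_congr rfl fun p _ => ?_
  rw [← Finset.mul_sum, iteratedDeriv_fun_sum
    fun i hi => ((hF i hi).of_le le_top).contDiffAt]

theorem app_add {f g : ℂ → ℂ} (hf : ContDiff ℂ ⊤ f) (hg : ContDiff ℂ ⊤ g) (c : Cond) :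
    c.app (fun z => f z + g z) = c.app f + c.app g := by
  simp only [app, Finsupp.sum]
  rw [← Finset.sum_add_distrib]
  refine Finset.sum_congr rfl fun p _ => ?_
  rw [← mul_add, iteratedDeriv_fun_add (hf.of_le le_top).contDiffAt (hg.of_le le_top).contDiffAt]

theorem app_const_mul (a : ℂ) (f : ℂ → ℂ) (c : Cond) :
    c.app (fun z => a * f z) = a * c.app f := by
  simp only [app, Finsupp.sum]
  rw [Finset.mul_sum]
  refine Finset.sum_congr rfl fun p _ => ?_
  rw [iteratedDeriv_const_mul_field]
  ring

end Cond

theorem contDiff_pow_mul_exp (j : ℕ) (s t : ℂ) :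
    ContDiff ℂ ⊤ fun z : ℂ => z ^ j * Complex.exp (s * z + t * z ^ 2) := by
  fun_prop

theorem iteratedDeriv_succ_pow_mul_exp (l j : ℕ) (s t a : ℂ) :
    iteratedDeriv (l + 1) (fun z : ℂ => z ^ j * Complex.exp (s * z + t * z ^ 2)) a =
      j * iteratedDeriv l (fun z : ℂ => z ^ (j - 1) * Complex.exp (s * z + t * z ^ 2)) a +
      s * iteratedDeriv l (fun z : ℂ => z ^ j * Complex.exp (s * z + t * z ^ 2)) a +
      2 * t * iteratedDeriv l (fun z : ℂ => z ^ (j + 1) * Complex.exp (s * z + t * z ^ 2)) a := by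
  have hd : deriv (fun z : ℂ => z ^ j * Complex.exp (s * z + t * z ^ 2)) = fun z : ℂ =>
      j * (z ^ (j - 1) * Complex.exp (s * z + t * z ^ 2)) +
      s * (z ^ j * Complex.exp (s * z + t * z ^ 2)) +
      2 * t * (z ^ (j + 1) * Complex.exp (s * z + t * z ^ 2)) := by
    funext z
    have h1 : HasDerivAt (fun z : ℂ => s * z + t * z ^ 2) (s + t * (2 * z)) z := by
      refine (((hasDerivAt_id' z).const_mul s).fun_add
        ((hasDerivAt_pow 2 z).const_mul t)).congr_deriv ?_
      simp
    rw [((hasDerivAt_pow j z).fun_mul h1.cexp).deriv]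
    ring
  have c0 := fun i => (contDiff_pow_mul_exp i s t).of_le (m := (l : WithTop ℕ∞)) le_top
  rw [iteratedDeriv_succ', hd, iteratedDeriv_fun_add, iteratedDeriv_fun_add,
    iteratedDeriv_const_mul_field, iteratedDeriv_const_mul_field, iteratedDeriv_const_mul_field]
  · exact (contDiff_const.mul (c0 _)).contDiffAt
  · exact (contDiff_const.mul (c0 _)).contDiffAt
  · exact ((contDiff_const.mul (c0 _)).add (contDiff_const.mul (c0 _))).contDiffAt
  · exact (contDiff_const.mul (c0 _)).contDiffAt

/-- Along a curve `(σ, τ)` in the space of the times `s, t`, differentiation of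
`e^{sz + tz²}` brings down `σ' z + τ' z²`, also after differentiations in `z`. -/
theorem hasDerivAt_iteratedDeriv_pow_mul_exp {σ τ : ℂ → ℂ} {σ' τ' u : ℂ}
    (hσ : HasDerivAt σ σ' u) (hτ : HasDerivAt τ τ' u) (a : ℂ) (l : ℕ) : ∀ j : ℕ,
    HasDerivAt
      (fun v => iteratedDeriv l (fun z : ℂ => z ^ j * Complex.exp (σ v * z + τ v * z ^ 2)) a)
      (σ' * iteratedDeriv l
          (fun z : ℂ => z ^ (j + 1) * Complex.exp (σ u * z + τ u * z ^ 2)) a +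
        τ' * iteratedDeriv l
          (fun z : ℂ => z ^ (j + 2) * Complex.exp (σ u * z + τ u * z ^ 2)) a) u := by
  induction l with
  | zero =>
    intro j
    simp only [iteratedDeriv_zero]
    refine (((hσ.mul_const a).fun_add (hτ.mul_const (a ^ 2))).cexp.const_mul (a ^ j)).congr_deriv ?_
    ring
  | succ l ih =>
    intro j
    simp only [iteratedDeriv_succ_pow_mul_exp]
    refine ((((ih (j - 1)).const_mul (j : ℂ)).fun_add (hσ.fun_mul (ih j))).fun_add
      ((hτ.const_mul 2).fun_mul (ih (j + 1)))).congr_deriv ?_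
    obtain ⟨H, hH⟩ : ∃ H : ℕ → ℂ, ∀ i, iteratedDeriv l
        (fun z : ℂ => z ^ i * Complex.exp (σ u * z + τ u * z ^ 2)) a = H i := ⟨_, fun _ => rfl⟩
    simp only [hH]
    rcases j with _ | j
    · simp
      ring
    · simp only [Nat.add_sub_cancel, show j + 1 + 2 - 1 = j + 2 from rfl,
        show j + 1 + 1 = j + 2 from rfl, show j + 1 + 2 = j + 3 from rfl,
        show j + 3 + 1 = j + 4 from rfl]
      push_cast
      ring

theorem Cond.hasDerivAt_app_pow_mul_exp {σ τ : ℂ → ℂ} {σ' τ' u : ℂ}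
    (hσ : HasDerivAt σ σ' u) (hτ : HasDerivAt τ τ' u) (c : Cond) (j : ℕ) :
    HasDerivAt
      (fun v => c.app fun z : ℂ => z ^ j * Complex.exp (σ v * z + τ v * z ^ 2))
      (σ' * c.app (fun z : ℂ => z ^ (j + 1) * Complex.exp (σ u * z + τ u * z ^ 2)) +
        τ' * c.app (fun z : ℂ => z ^ (j + 2) * Complex.exp (σ u * z + τ u * z ^ 2))) u := by
  have h := HasDerivAt.fun_sum (u := c.support) fun p _ =>
    (hasDerivAt_iteratedDeriv_pow_mul_exp hσ hτ p.2 p.1 j).const_mul (c p)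
  simp only [Cond.app, Finsupp.sum]
  refine h.congr_deriv ?_
  rw [Finset.mul_sum, Finset.mul_sum, ← Finset.sum_add_distrib]
  refine Finset.sum_congr rfl fun p _ => ?_
  ring

/-! ### Conditions at one point as polynomials -/

/-- The condition `∑ aₗ d(l, a)` at the point `a` that corresponds to the polynomial `∑ aₗ Xˡ`. -/
noncomputable def Cond.ofPoly (a : ℂ) : ℂ[X] →ₗ[ℂ] Cond :=
  Polynomial.lsum fun l => Finsupp.lsingle (l, a)

theorem Cond.ofPoly_monomial (a : ℂ) (l : ℕ) (k : ℂ) :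
    Cond.ofPoly a (monomial l k) = Finsupp.single (l, a) k := by
  simp [Cond.ofPoly, Polynomial.lsum]

theorem Cond.exists_ofPoly_eq {a : ℂ} {c : Cond} (hc : c ∈ Cond.at a) :
    ∃ p : ℂ[X], Cond.ofPoly a p = c := by
  have h : Cond.at a ≤ LinearMap.range (Cond.ofPoly a) := by
    rw [Cond.at, Submodule.span_le]
    rintro _ ⟨l, rfl⟩
    exact ⟨monomial l 1, Cond.ofPoly_monomial a l 1⟩
  exact h hc

/-- The operator `p ↦ p' + a p`, which is differentiation of `e^{ax} p(x)` with the
exponential factor stripped off. -/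
noncomputable def twistDeriv (a : ℂ) : ℂ[X] →ₗ[ℂ] ℂ[X] := derivative + a • LinearMap.id

theorem twistDeriv_apply (a : ℂ) (p : ℂ[X]) : twistDeriv a p = derivative p + C a * p := by
  simp [twistDeriv, smul_eq_C_mul]

theorem hasDerivAt_exp_mul_eval (a x : ℂ) (p : ℂ[X]) :
    HasDerivAt (fun x => Complex.exp (a * x) * p.eval x)
      (Complex.exp (a * x) * (twistDeriv a p).eval x) x := by
  have h1 : HasDerivAt (fun x : ℂ => a * x) a x := by
    simpa using (hasDerivAt_id x).const_mul a
  refine (h1.cexp.fun_mul (p.hasDerivAt x)).congr_deriv ?_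
  rw [twistDeriv_apply, eval_add, eval_mul, eval_C]
  ring

theorem Cond.ofPoly_app_pow_mul_exp (a x : ℂ) (p : ℂ[X]) (j : ℕ) :
    (Cond.ofPoly a p).app (fun z : ℂ => z ^ j * Complex.exp (x * z + 0 * z ^ 2)) =
      Complex.exp (a * x) * (((twistDeriv a) ^ j) p).eval x := by
  induction j generalizing x with
  | zero =>
    rw [← Cond.appLin_apply]
    simp only [pow_zero, Module.End.one_apply]
    induction p using Polynomial.induction_on' with
    | add p q hp hq => rw [map_add, map_add, hp, hq, eval_add, mul_add]
    | monomial l k =>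
      rw [Cond.ofPoly_monomial, Cond.appLin, Finsupp.linearCombination_single, eval_monomial]
      have : (fun z : ℂ => 1 * Complex.exp (x * z + 0 * z ^ 2)) =
          fun z => Complex.exp (x * z) := by
        funext z; simp
      rw [this, iteratedDeriv_cexp_const_mul, smul_eq_mul]
      simp only [mul_comm x a]
      ring
  | succ j ih =>
    have h1 := Cond.hasDerivAt_app_pow_mul_exp (hasDerivAt_id x) (hasDerivAt_const x (0 : ℂ))
      (Cond.ofPoly a p) j
    have h2 := hasDerivAt_exp_mul_eval a x (((twistDeriv a) ^ j) p)
    simp only [id_eq, ih] at h1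
    rw [pow_succ', Module.End.mul_apply, h2.unique h1]
    ring

/-! ### Expansion at infinity -/

theorem Polynomial.eventually_cobounded_eval_ne_zero {q : ℂ[X]} (hq : q ≠ 0) :
    ∀ᶠ z in Bornology.cobounded ℂ, q.eval z ≠ 0 := by
  have h : Bornology.IsBounded {z : ℂ | q.eval z = 0} := by
    refine (q.roots.toFinset.finite_toSet.subset fun z hz => ?_).isBounded
    simpa [hq] using hz
  exact h

theorem Polynomial.eventually_atTop_eval_ne_zero {q : ℂ[X]} (hq : q ≠ 0) :
    ∀ᶠ R : ℝ in atTop, ∀ z : ℂ, ‖z‖ = R → q.eval z ≠ 0 := by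
  have h := eventually_cobounded_eval_ne_zero hq
  rwa [← comap_norm_atTop, eventually_comap] at h

theorem Polynomial.exists_hasSum_eval_div_eval_sub_one {g q : ℂ[X]} (hg : g.Monic) (hq : q.Monic)
    (hd : g.natDegree = q.natDegree) :
    ∃ α : ℕ → ℂ, ∀ᶠ z in Bornology.cobounded ℂ,
      HasSum (fun k : ℕ => α (k + 1) * (z ^ (k + 1))⁻¹) (g.eval z / q.eval z - 1) := by
  -- With `u = z⁻¹` the quotient becomes one of the reversed polynomials, regular at `u = 0`.
  set F : ℂ → ℂ := fun u => g.reverse.eval u / q.reverse.eval u - 1 with hF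
  have hq0 : q.reverse.eval 0 = 1 := by
    rw [← coeff_zero_eq_eval_zero, coeff_zero_reverse, hq.leadingCoeff]
  have hg0 : g.reverse.eval 0 = 1 := by
    rw [← coeff_zero_eq_eval_zero, coeff_zero_reverse, hg.leadingCoeff]
  have hFa : AnalyticAt ℂ F 0 := by
    refine AnalyticAt.sub (AnalyticAt.div ?_ ?_ (by rw [hq0]; exact one_ne_zero)) analyticAt_const
    · exact (g.reverse.differentiable).analyticAt 0
    · exact (q.reverse.differentiable).analyticAt 0
  obtain ⟨p, hp⟩ := hFa
  refine ⟨fun k => p.coeff k, ?_⟩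
  have h1 := tendsto_inv₀_cobounded (α := ℂ) |>.eventually hp.eventually_hasSum
  filter_upwards [h1, eventually_cobounded_eval_ne_zero hq.ne_zero,
    Bornology.eventually_ne_cobounded (0 : ℂ)] with z hz hqz hz0
  have hF0 : p.coeff 0 = 0 := by
    have := hp.coeff_zero (fun _ => 0)
    rw [FormalMultilinearSeries.coeff]
    have h2 : F 0 = 0 := by simp [hF, hq0, hg0]
    rw [← h2, ← this]
    congr
    ext i
    exact i.elim0
  have hval : F (0 + z⁻¹) = g.eval z / q.eval z - 1 := by
    have hi : Invertible z := invertibleOfNonzero hz0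
    have e1 := eval₂_reverse_mul_pow (RingHom.id ℂ) z g
    have e2 := eval₂_reverse_mul_pow (RingHom.id ℂ) z q
    rw [invOf_eq_inv, eval₂_id, eval₂_id] at e1 e2
    simp only [hF, zero_add]
    rw [← e1, ← e2, hd, mul_div_mul_right _ _ (pow_ne_zero _ hz0)]
  rw [hval] at hz
  have h3 := (hasSum_nat_add_iff' 1).mpr hz
  simpa only [Finset.sum_range_one, FormalMultilinearSeries.apply_eq_pow_smul_coeff, hF0,
    smul_eq_mul, mul_zero, sub_zero, inv_pow, mul_comm _ (p.coeff _), zero_mul] using h3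

/-! ### Polynomial approximation of entire functions -/

theorem Differentiable.exists_polynomial_tendstoLocallyUniformlyOn {f : ℂ → ℂ}
    (hf : Differentiable ℂ f) :
    ∃ F : ℕ → ℂ[X], TendstoLocallyUniformlyOn (fun n z => (F n).eval z) f atTop Set.univ := by
  have h := (hf.hasFPowerSeriesOnBall 0 one_pos).tendstoLocallyUniformlyOn
  refine ⟨fun n => ∑ k ∈ Finset.range n, C ((cauchyPowerSeries f 0 (1 : NNReal)).coeff k) * X ^ k,
    ?_⟩
  simp only [Metric.eball_top, zero_add] at h
  refine h.congr fun n z _ => ?_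
  simp only [FormalMultilinearSeries.partialSum, eval_finsetSum, eval_mul, eval_C, eval_pow,
    eval_X, FormalMultilinearSeries.apply_eq_pow_smul_coeff, smul_eq_mul]
  exact Finset.sum_congr rfl fun k _ => mul_comm _ _

theorem TendstoLocallyUniformlyOn.tendsto_iteratedDeriv {F : ℕ → ℂ → ℂ} {f : ℂ → ℂ}
    (h : TendstoLocallyUniformlyOn F f atTop Set.univ) (hF : ∀ n, ContDiff ℂ ⊤ (F n)) (l : ℕ)
    (a : ℂ) : Tendsto (fun n => iteratedDeriv l (F n) a) atTop (𝓝 (iteratedDeriv l f a)) := by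
  induction l generalizing F f with
  | zero => simpa using h.tendsto_at (Set.mem_univ a)
  | succ l ih =>
    simp only [iteratedDeriv_succ']
    refine ih (h.deriv (.of_forall fun n => ?_) isOpen_univ) fun n => ?_
    · exact ((hF n).differentiable (by simp)).differentiableOn
    · have := hF n
      fun_prop

theorem Polynomial.contDiff_eval (p : ℂ[X]) : ContDiff ℂ ⊤ fun z => p.eval z :=
  p.contDiff_aeval ⊤

theorem Cond.tendsto_app {F : ℕ → ℂ[X]} {f : ℂ → ℂ}
    (h : TendstoLocallyUniformlyOn (fun n z => (F n).eval z) f atTop Set.univ) (c : Cond) :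
    Tendsto (fun n => c.app fun z => (F n).eval z) atTop (𝓝 (c.app f)) := by
  refine tendsto_finsetSum _ fun p _ => Tendsto.const_mul _ ?_
  exact h.tendsto_iteratedDeriv (fun n => (F n).contDiff_eval) _ _

/-! ### Construction of the stationary wave function -/

theorem Polynomial.degree_sum_C_mul_X_pow_lt {d : ℕ} (w : Fin d → ℂ) :
    (∑ j : Fin d, C (w j) * X ^ (j : ℕ)).degree < (X ^ d : ℂ[X]).degree := by
  rw [degree_X_pow]
  exact degree_sum_fin_lt w

theorem Polynomial.monic_X_pow_sub_sum {d : ℕ} (w : Fin d → ℂ) :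
    (X ^ d - ∑ j : Fin d, C (w j) * X ^ (j : ℕ)).Monic :=
  monic_X_pow_sub (degree_sum_fin_lt w)

theorem Polynomial.natDegree_X_pow_sub_sum {d : ℕ} (w : Fin d → ℂ) :
    (X ^ d - ∑ j : Fin d, C (w j) * X ^ (j : ℕ)).natDegree = d := by
  rw [natDegree_eq_of_degree_eq (degree_sub_eq_left_of_degree_lt (degree_sum_C_mul_X_pow_lt w)),
    natDegree_X_pow]

theorem Cond.app_X_pow_sub_sum_mul_exp {d : ℕ} (w : Fin d → ℂ) (x : ℂ) (c : Cond) :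
    c.app (fun z => (X ^ d - ∑ j : Fin d, C (w j) * X ^ (j : ℕ)).eval z * Complex.exp (x * z)) =
      c.app (fun z => z ^ d * Complex.exp (x * z + 0 * z ^ 2)) -
      ∑ j : Fin d, w j * c.app fun z => z ^ (j : ℕ) * Complex.exp (x * z + 0 * z ^ 2) := by
  have e : ∀ z : ℂ, (X ^ d - ∑ j : Fin d, C (w j) * X ^ (j : ℕ)).eval z * Complex.exp (x * z) =
      z ^ d * Complex.exp (x * z + 0 * z ^ 2) +
      ∑ j : Fin d, -w j * (z ^ (j : ℕ) * Complex.exp (x * z + 0 * z ^ 2)) := by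
    intro z
    simp only [eval_sub, eval_pow, eval_X, eval_finsetSum, eval_mul, eval_C, zero_mul,
      add_zero, sub_mul, Finset.sum_mul, neg_mul, Finset.sum_neg_distrib, mul_assoc]
    rw [sub_eq_add_neg]
  rw [Cond.app_congr e, Cond.app_add (contDiff_pow_mul_exp _ _ _), Cond.app_sum]
  · simp only [Cond.app_const_mul]
    simp only [neg_mul, Finset.sum_neg_distrib]
    rw [sub_eq_add_neg]
  · exact fun j _ => contDiff_const.mul (contDiff_pow_mul_exp _ _ _)
  · exact ContDiff.sum fun j _ => contDiff_const.mul (contDiff_pow_mul_exp _ _ _)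

namespace Gr1Star

/-- The values on a polynomial of the conditions of a basis of `C`. -/
noncomputable def condMap (P : Gr1Star) : ℂ[X] →ₗ[ℂ] Fin P.dim → ℂ where
  toFun f i := Cond.app (Module.finBasis ℂ P.space i : Cond) fun z => f.eval z
  map_add' f g := by
    ext i
    simp only [eval_add]
    exact Cond.app_add f.contDiff_eval g.contDiff_eval _
  map_smul' a f := by
    ext i
    simp only [eval_smul, smul_eq_mul]
    exact Cond.app_const_mul _ _ _

theorem app_eq_zero_of_basis (P : Gr1Star) {ι : Type*} (b : Module.Basis ι ℂ P.space)
    {f : ℂ → ℂ} (h : ∀ i, (b i : Cond).app f = 0) {c : Cond} (hc : c ∈ P.space) :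
    c.app f = 0 := by
  have h1 : (Cond.appLin f).comp P.space.subtype = 0 :=
    b.ext fun i => by simpa [Cond.appLin_apply] using h i
  exact LinearMap.congr_fun h1 ⟨c, hc⟩

theorem mem_V_iff (P : Gr1Star) (f : ℂ[X]) : f ∈ P.V ↔ P.condMap f = 0 :=
  ⟨fun h => funext fun i => h _ (Module.finBasis ℂ P.space i).2,
    fun h _ hc => P.app_eq_zero_of_basis (Module.finBasis ℂ P.space) (fun i => congrFun h i) hc⟩

/-- The matrix whose determinant is `tau` up to an exponential factor. -/
noncomputable def tauMatrix (P : Gr1Star) (s t : ℂ) : Matrix (Fin P.dim) (Fin P.dim) ℂ :=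
  Matrix.of fun i j : Fin P.dim => Cond.app (Module.finBasis ℂ P.space i : Cond)
    fun z => z ^ (j : ℕ) * Complex.exp (s * z + t * z ^ 2)

theorem tau_eq (P : Gr1Star) (s t : ℂ) : P.tau s t =
    (P.q.roots.map fun l => Complex.exp (-(l * s + l ^ 2 * t))).prod * (P.tauMatrix s t).det := rfl

theorem prod_exp_ne_zero (r : Multiset ℂ) (f : ℂ → ℂ) :
    (r.map fun l => Complex.exp (f l)).prod ≠ 0 := by
  simp [Multiset.prod_eq_zero_iff, Complex.exp_ne_zero]

/-- The columns of `tauMatrix` are limits of values of `condMap` and span the target, while the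
range of `condMap`, being finite dimensional, is closed. -/
theorem condMap_surjective (P : Gr1Star) {x : ℂ} (hx : P.tau x 0 ≠ 0) :
    Function.Surjective P.condMap := by
  have hdet : IsUnit (P.tauMatrix x 0).det := by
    rw [isUnit_iff_ne_zero]
    rw [tau_eq] at hx
    exact right_ne_zero_of_mul hx
  have hcol : ∀ j : Fin P.dim, (fun i => P.tauMatrix x 0 i j) ∈ LinearMap.range P.condMap := by
    intro j
    obtain ⟨F, hF⟩ := ((contDiff_pow_mul_exp j x 0).differentiable
      (by simp)).exists_polynomial_tendstoLocallyUniformlyOn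
    refine (Submodule.closed_of_finiteDimensional _).mem_of_tendsto
      (tendsto_pi_nhds.mpr fun i => Cond.tendsto_app hF _) (.of_forall fun n => ⟨F n, rfl⟩)
  intro v
  have hv : v = ∑ j, ((P.tauMatrix x 0)⁻¹.mulVec v) j • fun i => P.tauMatrix x 0 i j := by
    conv_lhs => rw [← Matrix.one_mulVec v, ← Matrix.mul_nonsing_inv _ hdet,
      ← Matrix.mulVec_mulVec]
    ext i
    simp [Matrix.mulVec, dotProduct, mul_comm]
  change v ∈ LinearMap.range P.condMap
  rw [hv]
  exact Submodule.sum_mem _ fun j _ => Submodule.smul_mem _ _ (hcol j)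

/-- An entire function `f` that satisfies the conditions of `C` is a limit of members of `V_C`,
so `f / q` lies in `W`. Polynomial approximations of `f` are corrected by a right inverse of
`condMap`; the corrections tend to zero since the target of `condMap` is finite dimensional. -/
theorem exists_mem_W_of_app_eq_zero (P : Gr1Star) {x : ℂ} (hx : P.tau x 0 ≠ 0) {f : ℂ → ℂ}
    (hf : Differentiable ℂ f) (hc : ∀ c ∈ P.space, c.app f = 0) {R : ℝ}
    (hR : ∀ z : ℂ, ‖z‖ = |R| → P.q.eval z ≠ 0) : ∃ h ∈ P.W R,
      (h : UnitAddCircle → ℂ) =ᵐ[AddCircle.haarAddCircle] onCircle R fun z => f z / P.q.eval z := by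
  have hcirc : ∀ θ : UnitAddCircle, ‖(R : ℂ) * (AddCircle.toCircle θ : ℂ)‖ = |R| := by
    intro θ; simp [Circle.norm_coe]
  have hcont : Continuous fun θ : UnitAddCircle => (R : ℂ) * (AddCircle.toCircle θ : ℂ) :=
    continuous_const.mul (continuous_subtype_val.comp AddCircle.continuous_toCircle)
  let Qi : C(UnitAddCircle, ℂ) := ⟨fun θ => (P.q.eval ((R : ℂ) * (AddCircle.toCircle θ : ℂ)))⁻¹,
    (P.q.continuous.comp hcont).inv₀ fun θ => hR _ (hcirc θ)⟩
  let res : ℂ[X] →ₗ[ℂ] C(UnitAddCircle, ℂ) :=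
    { toFun := fun p => ⟨fun θ => p.eval ((R : ℂ) * (AddCircle.toCircle θ : ℂ)),
        p.continuous.comp hcont⟩
      map_add' := fun p r => by ext θ; simp
      map_smul' := fun a p => by ext θ; simp }
  let f₀ : C(UnitAddCircle, ℂ) := ⟨fun θ => f ((R : ℂ) * (AddCircle.toCircle θ : ℂ)),
    hf.continuous.comp hcont⟩
  obtain ⟨F, hF⟩ := hf.exists_polynomial_tendstoLocallyUniformlyOn
  obtain ⟨S, hS⟩ := P.condMap.exists_rightInverse_of_surjective
    (LinearMap.range_eq_top.mpr (P.condMap_surjective hx))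
  have h1 : Tendsto (fun n => res (F n)) atTop (𝓝 f₀) := by
    rw [ContinuousMap.tendsto_iff_tendstoUniformly]
    have h2 := (tendstoLocallyUniformlyOn_iff_forall_isCompact isOpen_univ).mp hF
      (Metric.closedBall 0 |R|) (Set.subset_univ _) (isCompact_closedBall _ _)
    rw [Metric.tendstoUniformlyOn_iff] at h2
    rw [Metric.tendstoUniformly_iff]
    intro ε hε
    filter_upwards [h2 ε hε] with n hn θ
    exact hn _ (by rw [mem_closedBall_zero_iff, hcirc θ])
  have h2 : Tendsto (fun n => P.condMap (F n)) atTop (𝓝 0) := by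
    rw [tendsto_pi_nhds]
    intro i
    have := Cond.tendsto_app hF (Module.finBasis ℂ P.space i : Cond)
    rwa [hc _ (Module.finBasis ℂ P.space i).2] at this
  have h3 : Tendsto (fun n => res (F n - S (P.condMap (F n)))) atTop (𝓝 f₀) := by
    have h4 := ((res ∘ₗ S).continuous_of_finiteDimensional.tendsto 0).comp h2
    rw [map_zero] at h4
    simpa using h1.sub h4
  -- The corrected polynomials lie in `V_C`.
  have hV : ∀ n, F n - S (P.condMap (F n)) ∈ P.V := by
    intro n
    rw [mem_V_iff, map_sub]
    have := LinearMap.congr_fun hS (P.condMap (F n))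
    rw [LinearMap.comp_apply, LinearMap.id_apply] at this
    rw [this, sub_self]
  let T : C(UnitAddCircle, ℂ) →L[ℂ] CircleL2 :=
    ContinuousMap.toLp 2 (AddCircle.haarAddCircle : Measure UnitAddCircle) ℂ
  refine ⟨T (f₀ * Qi), ?_, ?_⟩
  · refine mem_closure_of_tendsto ((T.continuous.tendsto _).comp (h3.mul_const Qi))
      (.of_forall fun n => ⟨_, hV n, ?_⟩)
    exact (ContinuousMap.coeFn_toLp _ _)
  · exact (ContinuousMap.coeFn_toLp _ _)

/-- If `g` is monic of degree `dim C` and `g(z)e^{xz}` satisfies the conditions of `C`, then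
`q⁻¹ g e^{xz}` has all properties of the stationary wave function at `x`. -/
theorem wave_of_monic (P : Gr1Star) {x : ℂ} (hx : P.tau x 0 ≠ 0) {g : ℂ[X]} (hg : g.Monic)
    (hd : g.natDegree = P.dim)
    (hc : ∀ c ∈ P.space, c.app (fun z => g.eval z * Complex.exp (x * z)) = 0) {φ : ℂ → ℂ}
    (hφ : ∀ z, P.q.eval z ≠ 0 → φ z = g.eval z / P.q.eval z * Complex.exp (x * z)) :
    DifferentiableOn ℂ φ {z | P.q.eval z ≠ 0} ∧
    (∃ α : ℕ → ℂ, ∀ᶠ z in Bornology.cobounded ℂ,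
      HasSum (fun k : ℕ => α (k + 1) * (z ^ (k + 1))⁻¹)
        (φ z * Complex.exp (-(x * z)) - 1)) ∧
    ∀ᶠ R : ℝ in atTop, ∃ h ∈ P.W R,
      (h : UnitAddCircle → ℂ) =ᵐ[AddCircle.haarAddCircle] onCircle R φ := by
  refine ⟨?_, ?_, ?_⟩
  · refine DifferentiableOn.congr (f := fun z => g.eval z / P.q.eval z * Complex.exp (x * z)) ?_
      fun z hz => hφ z hz
    refine (g.differentiable.differentiableOn.div P.q.differentiable.differentiableOn
      fun z hz => hz).mul ?_
    fun_prop
  · obtain ⟨α, hα⟩ := exists_hasSum_eval_div_eval_sub_one hg P.monic (hd.trans P.natDegree_eq.symm)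
    refine ⟨α, ?_⟩
    filter_upwards [hα, eventually_cobounded_eval_ne_zero P.monic.ne_zero] with z hz hqz
    rwa [hφ z hqz, mul_assoc, ← Complex.exp_add, add_neg_cancel, Complex.exp_zero, mul_one]
  · filter_upwards [eventually_atTop_eval_ne_zero P.monic.ne_zero, eventually_ge_atTop 0]
      with R hR hR0
    rw [← abs_of_nonneg hR0] at hR
    obtain ⟨h, hW, hh⟩ := P.exists_mem_W_of_app_eq_zero hx
      (f := fun z => g.eval z * Complex.exp (x * z)) (by fun_prop) hc
      (R := R) (by simpa using hR)
    refine ⟨h, hW, hh.trans (.of_forall fun θ => ?_)⟩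
    have : P.q.eval ((R : ℂ) * (AddCircle.toCircle θ : ℂ)) ≠ 0 := hR _ (by simp [Circle.norm_coe])
    simp only [onCircle]
    rw [hφ _ this]
    ring

theorem exists_monic_app_eq_zero (P : Gr1Star) {x : ℂ} (hx : P.tau x 0 ≠ 0) :
    ∃ g : ℂ[X], g.Monic ∧ g.natDegree = P.dim ∧
      ∀ c ∈ P.space, c.app (fun z => g.eval z * Complex.exp (x * z)) = 0 := by
  have hdet : IsUnit (P.tauMatrix x 0).det := by
    rw [isUnit_iff_ne_zero]
    rw [tau_eq] at hx
    exact right_ne_zero_of_mul hx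
  set v : Fin P.dim → ℂ := fun i => Cond.app (Module.finBasis ℂ P.space i : Cond)
    fun z => z ^ P.dim * Complex.exp (x * z + 0 * z ^ 2) with hv
  set w := (P.tauMatrix x 0)⁻¹.mulVec v with hw
  have hAw : (P.tauMatrix x 0).mulVec w = v := by
    rw [hw, Matrix.mulVec_mulVec, Matrix.mul_nonsing_inv _ hdet, Matrix.one_mulVec]
  refine ⟨_, monic_X_pow_sub_sum w, natDegree_X_pow_sub_sum w, fun c hc => ?_⟩
  refine P.app_eq_zero_of_basis (Module.finBasis ℂ P.space) (fun i => ?_) hc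
  rw [Cond.app_X_pow_sub_sum_mul_exp, sub_eq_zero]
  refine (congrFun hAw i).symm.trans ?_
  change ∑ j, P.tauMatrix x 0 i j * w j = _
  exact Finset.sum_congr rfl fun j _ => mul_comm _ _

end Gr1Star

/-! ### Determinants with shifted columns -/

section Columns

variable {R : Type*} [CommRing R] {m : ℕ}

/-- The square matrix of size `m + 1` whose columns are the first members of a sequence of
columns. -/
def columns (v : ℕ → Fin (m + 1) → R) : Matrix (Fin (m + 1)) (Fin (m + 1)) R :=
  Matrix.of fun i j => v j i

theorem det_columns_updateCol_eq_zero (v : ℕ → Fin (m + 1) → R) (j : Fin (m + 1)) {k : ℕ}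
    (hk : k < m + 1) (hjk : k ≠ j) : ((columns v).updateCol j (v k)).det = 0 := by
  have : v k = (columns v).col ⟨k, hk⟩ := rfl
  rw [this]
  exact Matrix.det_updateCol_eq_zero (by
    intro h
    exact hjk (congrArg Fin.val h))

/-- Shifting the columns one at a time by one place leaves only the term in which the last
column is shifted. -/
theorem sum_det_updateCol_succ (v : ℕ → Fin (m + 1) → R) :
    ∑ j : Fin (m + 1), ((columns v).updateCol j (v (j + 1))).det =
      ((columns v).updateCol (Fin.last m) (v (m + 1))).det := by
  rw [Fin.sum_univ_castSucc, Finset.sum_eq_zero, zero_add, Fin.val_last]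
  intro j _
  apply det_columns_updateCol_eq_zero <;> simp

theorem sum_det_updateCol_add_two (v : ℕ → Fin (m + 1) → R) :
    ∑ j : Fin (m + 1), ((columns v).updateCol j (v (j + 2))).det =
      ((columns v).updateCol (Fin.last m) (v (m + 2))).det +
      ∑ j : Fin (m + 1), if (j : ℕ) + 1 = m then
        ((columns v).updateCol j (v (m + 1))).det else 0 := by
  rw [Fin.sum_univ_castSucc, Fin.sum_univ_castSucc (n := m)
    (f := fun j => if (j : ℕ) + 1 = m then _ else _)]
  simp only [Fin.val_last, Nat.succ_ne_self, if_false, add_zero, Fin.val_castSucc]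
  rw [add_comm]
  congr 1
  refine Finset.sum_congr rfl fun j _ => ?_
  split_ifs with h
  · rw [show (j : ℕ) + 2 = m + 1 by omega]
  · apply det_columns_updateCol_eq_zero
    · have := j.2
      omega
    · simp

/-- The analogue of `sum_det_updateCol_add_two` for the second derivative: shift the last column,
then shift the columns of the result one at a time. -/
theorem sum_det_updateCol_last_succ (v : ℕ → Fin (m + 1) → R) :
    ∑ j : Fin (m + 1), (((columns v).updateCol (Fin.last m) (v (m + 1))).updateCol j
        (if j = Fin.last m then v (m + 2) else v (j + 1))).det =
      ((columns v).updateCol (Fin.last m) (v (m + 2))).det -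
      ∑ j : Fin (m + 1), if (j : ℕ) + 1 = m then
        ((columns v).updateCol j (v (m + 1))).det else 0 := by
  rw [Fin.sum_univ_castSucc, Fin.sum_univ_castSucc (n := m)
    (f := fun j => if (j : ℕ) + 1 = m then _ else _)]
  simp only [Fin.val_last, Nat.succ_ne_self, if_false, add_zero, Fin.val_castSucc, if_true,
    Matrix.updateCol_idem, Fin.castSucc_ne_last]
  rw [add_comm, sub_eq_add_neg, ← Finset.sum_neg_distrib]
  congr 1
  refine Finset.sum_congr rfl fun j _ => ?_
  have hj := j.2
  split_ifs with h
  · -- The two matrices differ by the exchange of the last two columns.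
    have hne : j.castSucc ≠ Fin.last m := Fin.castSucc_ne_last j
    have e : ((columns v).updateCol (Fin.last m) (v (m + 1))).updateCol j.castSucc (v (j + 1)) =
        ((columns v).updateCol j.castSucc (v (m + 1))).submatrix id
          (Equiv.swap j.castSucc (Fin.last m)) := by
      ext i k
      rw [Matrix.submatrix_apply, id]
      by_cases hk : k = j.castSucc
      · rw [hk, Equiv.swap_apply_left, Matrix.updateCol_self, Matrix.updateCol_ne hne.symm]
        simp [columns, h]
      · rw [Matrix.updateCol_ne hk]
        by_cases hk' : k = Fin.last m
        · rw [hk', Equiv.swap_apply_right, Matrix.updateCol_self, Matrix.updateCol_self]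
        · rw [Equiv.swap_apply_of_ne_of_ne hk hk', Matrix.updateCol_ne hk,
            Matrix.updateCol_ne hk']
    rw [e, Matrix.det_permute', Equiv.Perm.sign_swap hne]
    simp
  · rw [neg_zero]
    have : v (j + 1) = ((columns v).updateCol (Fin.last m) (v (m + 1))).col
        ⟨j + 1, by omega⟩ := by
      ext i
      have : (⟨j + 1, by omega⟩ : Fin (m + 1)) ≠ Fin.last m := by
        intro h'
        exact h (congrArg Fin.val h')
      simp [Matrix.col, this, columns]
    rw [this]
    exact Matrix.det_updateCol_eq_zero (by simp [Fin.ext_iff])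

end Columns

theorem Matrix.det_updateCol_eq_sum {R : Type*} [CommRing R] {n : Type*} [Fintype n]
    [DecidableEq n] (B : Matrix n n R) (j : n) (w : n → R) : (B.updateCol j w).det =
      ∑ σ : Equiv.Perm n, (Equiv.Perm.sign σ : ℤ) *
        ((∏ i ∈ Finset.univ.erase j, B (σ i) i) * w (σ j)) := by
  rw [Matrix.det_apply']
  refine Finset.sum_congr rfl fun σ _ => ?_
  rw [← Finset.prod_erase_mul _ _ (Finset.mem_univ j), Matrix.updateCol_self]
  congr 2
  refine Finset.prod_congr rfl fun i hi => ?_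
  rw [Matrix.updateCol_ne (Finset.ne_of_mem_erase hi)]

/-- The derivative of a determinant, by columns, if the `i`-th row is multiplied by an exponential
whose logarithmic derivative is `l i`. -/
theorem Polynomial.derivative_det_add {R : Type*} [CommRing R] {n : Type*} [Fintype n]
    [DecidableEq n] (l : n → R) (B S : Matrix n n R[X])
    (h : ∀ i j, derivative (B i j) + C (l i) * B i j = S i j) :
    derivative B.det + C (∑ i, l i) * B.det = ∑ j, (B.updateCol j fun i => S i j).det := by
  simp only [Matrix.det_updateCol_eq_sum]
  rw [Finset.sum_comm, Matrix.det_apply', derivative_sum, Finset.mul_sum,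
    ← Finset.sum_add_distrib]
  refine Finset.sum_congr rfl fun σ _ => ?_
  rw [← Finset.mul_sum, derivative_intCast_mul, mul_left_comm, ← mul_add]
  congr 1
  rw [derivative_prod_finset, ← Equiv.sum_comp σ l, map_sum, Finset.sum_mul,
    ← Finset.sum_add_distrib]
  refine Finset.sum_congr rfl fun j _ => ?_
  rw [← h, ← Finset.prod_erase_mul _ _ (Finset.mem_univ j)]
  ring

theorem HasDerivAt.det {n : Type*} [Fintype n] [DecidableEq n]
    {B : ℂ → Matrix n n ℂ} {S : Matrix n n ℂ} {u : ℂ}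
    (h : ∀ i j, HasDerivAt (fun v => B v i j) (S i j) u) :
    HasDerivAt (fun v => (B v).det) (∑ j, ((B u).updateCol j fun i => S i j).det) u := by
  simp only [Matrix.det_updateCol_eq_sum]
  rw [Finset.sum_comm]
  simp only [Matrix.det_apply']
  refine HasDerivAt.fun_sum fun σ _ => ?_
  rw [← Finset.mul_sum]
  refine HasDerivAt.const_mul _ ?_
  exact HasDerivAt.fun_finsetProd fun i _ => h (σ i) i

/-! ### The polynomial form of the wave function and its pole condition -/

section Wave

variable {M : ℕ}

/-- The column `(e^{-lᵢx} ∂ʲ (e^{lᵢx} pᵢ(x)))ᵢ`. -/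
noncomputable def twistCol (l : Fin M → ℂ) (p : Fin M → ℂ[X]) (j : ℕ) : Fin M → ℂ[X] :=
  fun i => (twistDeriv (l i) ^ j) (p i)

/-- The Wronskian matrix of the functions `e^{lᵢx} pᵢ(x)`, without its exponential factors. -/
noncomputable def twistMatrix (l : Fin M → ℂ) (p : Fin M → ℂ[X]) :
    Matrix (Fin M) (Fin M) ℂ[X] :=
  Matrix.of fun i j => twistCol l p j i

/-- The polynomials `Nⱼ(x)` for which the functions `e^{lᵢx} pᵢ(x)` are annihilated by the
differential operator `D ∂ᴹ - ∑ Nⱼ ∂ʲ`, where `D` is the Wronskian. -/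
noncomputable def waveCoeff (l : Fin M → ℂ) (p : Fin M → ℂ[X]) (j : Fin M) : ℂ[X] :=
  ((twistMatrix l p).updateCol j (twistCol l p M)).det

/-- The numerator `D(x) zᴹ - ∑ Nⱼ(x) zʲ` of the wave function, as a polynomial in `x`. -/
noncomputable def waveNum (l : Fin M → ℂ) (p : Fin M → ℂ[X]) (z : ℂ) : ℂ[X] :=
  C (z ^ M) * (twistMatrix l p).det - ∑ j : Fin M, C (z ^ (j : ℕ)) * waveCoeff l p j

theorem twistCol_succ (l : Fin M → ℂ) (p : Fin M → ℂ[X]) (j : ℕ) (i : Fin M) :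
    twistCol l p (j + 1) i = derivative (twistCol l p j i) + C (l i) * twistCol l p j i := by
  rw [twistCol, pow_succ', Module.End.mul_apply, twistDeriv_apply]
  rfl

theorem sum_twistCol_mul_waveCoeff (l : Fin M → ℂ) (p : Fin M → ℂ[X]) (i : Fin M) :
    ∑ j : Fin M, twistCol l p j i * waveCoeff l p j =
      (twistMatrix l p).det * twistCol l p M i := by
  have h := congrFun (Matrix.mulVec_cramer (twistMatrix l p) (twistCol l p M)) i
  simpa [Matrix.mulVec, dotProduct, Matrix.cramer_apply, twistMatrix, waveCoeff] using h

theorem derivative_det_twistMatrix (l : Fin M → ℂ) (p : Fin M → ℂ[X]) :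
    derivative (twistMatrix l p).det + C (∑ i, l i) * (twistMatrix l p).det =
      ∑ j : Fin M, ((twistMatrix l p).updateCol j (twistCol l p (j + 1))).det :=
  derivative_det_add l (twistMatrix l p) (Matrix.of fun i j => twistCol l p (j + 1) i)
    fun i j => (twistCol_succ l p j i).symm

theorem waveCoeff_last {m : ℕ} (l : Fin (m + 1) → ℂ) (p : Fin (m + 1) → ℂ[X]) :
    waveCoeff l p (Fin.last m) =
      derivative (twistMatrix l p).det + C (∑ i, l i) * (twistMatrix l p).det := by
  rw [derivative_det_twistMatrix]
  exact (sum_det_updateCol_succ (twistCol l p)).symm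

theorem derivative_waveCoeff_last {m : ℕ} (l : Fin (m + 1) → ℂ) (p : Fin (m + 1) → ℂ[X]) :
    derivative (waveCoeff l p (Fin.last m)) + C (∑ i, l i) * waveCoeff l p (Fin.last m) =
      ((twistMatrix l p).updateCol (Fin.last m) (twistCol l p (m + 2))).det -
      ∑ j : Fin (m + 1), if (j : ℕ) + 1 = m then waveCoeff l p j else 0 := by
  refine Eq.trans ?_ (sum_det_updateCol_last_succ (twistCol l p))
  refine Eq.trans (derivative_det_add l _ (Matrix.of fun i j => if j = Fin.last m then
    twistCol l p (m + 2) i else twistCol l p (j + 1) i) fun i j => ?_) ?_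
  · rw [Matrix.of_apply]
    by_cases hj : j = Fin.last m
    · rw [hj, Matrix.updateCol_self, if_pos rfl]
      exact (twistCol_succ l p (m + 1) i).symm
    · rw [Matrix.updateCol_ne hj, if_neg hj, twistCol_succ]
      rfl
  · refine Finset.sum_congr rfl fun j _ => ?_
    congr 2
    ext i
    by_cases hj : j = Fin.last m <;> simp [hj]

/-- The recursion for the coefficients of `z ↦ ∑ (c'ⱼ + z cⱼ) zʲ`, with the top term removed. -/
theorem sum_add_cons_mul {m : ℕ} (c c' : Fin (m + 1) → ℂ) (f : ℕ → ℂ) :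
    ∑ j : Fin (m + 1), (c' j + (Fin.cons 0 fun k : Fin m => c k.castSucc : Fin (m + 1) → ℂ) j) *
        f j =
      ∑ j : Fin (m + 1), c' j * f j + ∑ j : Fin (m + 1), c j * f (j + 1) -
        c (Fin.last m) * f (m + 1) := by
  simp only [add_mul, Finset.sum_add_distrib]
  rw [Fin.sum_univ_succ (fun j => (Fin.cons 0 fun k : Fin m => c k.castSucc : Fin (m + 1) → ℂ) j *
    f j), Fin.sum_univ_castSucc (fun j => c j * f (j + 1))]
  simp only [Fin.cons_zero, Fin.cons_succ, Fin.val_succ, Fin.val_castSucc, Fin.val_last]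
  ring

/-- The pole condition: at a simple zero `x₀` of the Wronskian that moves with velocity `2y` under
the second flow (`ht`), the numerator `f(x)` of the wave function, with its factor `e^{xz}`,
satisfies `f'(x₀) + (y - D''/(2D')) f(x₀) = 0`. -/
theorem waveNum_pole_condition (l : Fin M → ℂ) (p : Fin M → ℂ[X]) {x₀ y : ℂ}
    (h0 : (twistMatrix l p).det.eval x₀ = 0)
    (h1 : (derivative (twistMatrix l p).det).eval x₀ ≠ 0)
    (ht : 2 * y *
        (∑ j : Fin M, ((twistMatrix l p).updateCol j (twistCol l p (j + 1))).det).eval x₀ +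
        (∑ j : Fin M, ((twistMatrix l p).updateCol j (twistCol l p (j + 2))).det).eval x₀ = 0)
    (z : ℂ) :
    (derivative (waveNum l p z)).eval x₀ + z * (waveNum l p z).eval x₀ +
      (y - (derivative (derivative (twistMatrix l p).det)).eval x₀ /
        (2 * (derivative (twistMatrix l p).det).eval x₀)) * (waveNum l p z).eval x₀ = 0 := by
  rcases M with _ | m
  · simp [twistMatrix] at h0
  set D := (twistMatrix l p).det with hD
  set Λ := ∑ i, l i
  obtain ⟨c, hc⟩ : ∃ c : Fin (m + 1) → ℂ, ∀ j, (waveCoeff l p j).eval x₀ = c j :=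
    ⟨_, fun _ => rfl⟩
  obtain ⟨c', hc'⟩ : ∃ c' : Fin (m + 1) → ℂ, ∀ j, (derivative (waveCoeff l p j)).eval x₀ = c' j :=
    ⟨_, fun _ => rfl⟩
  set G := ∑ j : Fin (m + 1), if (j : ℕ) + 1 = m then c j else 0 with hG
  set E := ((twistMatrix l p).updateCol (Fin.last m) (twistCol l p (m + 2))).det.eval x₀ with hE
  have hGe : (∑ j : Fin (m + 1), if (j : ℕ) + 1 = m then waveCoeff l p j else 0).eval x₀ = G := by
    rw [eval_finsetSum, hG]
    refine Finset.sum_congr rfl fun j _ => ?_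
    split_ifs <;> simp [hc]
  -- The two leading coefficients and the relations between them.
  have r1 : c (Fin.last m) = (derivative D).eval x₀ := by
    rw [← hc, waveCoeff_last, eval_add, eval_mul, ← hD, h0]
    simp
  have r2 : c' (Fin.last m) = (derivative (derivative D)).eval x₀ + Λ * (derivative D).eval x₀ := by
    rw [← hc', waveCoeff_last, derivative_add, derivative_C_mul, eval_add, eval_mul, eval_C]
  have r3 : c' (Fin.last m) + Λ * c (Fin.last m) = E - G := by
    have := congrArg (eval x₀) (derivative_waveCoeff_last l p)
    rwa [eval_add, eval_mul, eval_C, hc, hc', eval_sub, hGe] at this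
  have r4 : 2 * y * (derivative D).eval x₀ + (E + G) = 0 := by
    rw [← derivative_det_twistMatrix, eval_add, eval_mul, ← hD, h0, mul_zero, add_zero] at ht
    have e := sum_det_updateCol_add_two (twistCol l p)
    change ∑ j : Fin (m + 1), ((twistMatrix l p).updateCol j (twistCol l p (j + 2))).det =
      ((twistMatrix l p).updateCol (Fin.last m) (twistCol l p (m + 2))).det +
      ∑ j : Fin (m + 1), (if (j : ℕ) + 1 = m then waveCoeff l p j else 0) at e
    rwa [e, eval_add, hGe] at ht
  set κ := (derivative (derivative D)).eval x₀ / (2 * (derivative D).eval x₀) - y with hκ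
  set e : Fin (m + 1) → ℂ :=
    fun j => c' j + (Fin.cons 0 fun k : Fin m => c k.castSucc : Fin (m + 1) → ℂ) j with he
  have hsum : ∀ f : ℕ → ℂ, ∑ j : Fin (m + 1), e j * f j =
      ∑ j : Fin (m + 1), c' j * f j + ∑ j : Fin (m + 1), c j * f (j + 1) -
        c (Fin.last m) * f (m + 1) := sum_add_cons_mul c c'
  have helast : e (Fin.last m) = κ * c (Fin.last m) := by
    have h2 := hsum fun k => if k = m then 1 else 0
    have h3 : ∀ d : Fin (m + 1) → ℂ,
        ∑ j : Fin (m + 1), d j * (if (j : ℕ) = m then 1 else 0) = d (Fin.last m) := by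
      intro d
      rw [Fin.sum_univ_castSucc, Finset.sum_eq_zero]
      · simp
      · intro j _
        have := j.2.ne
        simp [this]
    rw [h3, h3] at h2
    simp only [mul_ite, mul_one, mul_zero, Nat.succ_ne_self, if_false, sub_zero] at h2
    rw [h2, ← hG]
    have : κ * c (Fin.last m) =
        (derivative (derivative D)).eval x₀ / 2 - y * (derivative D).eval x₀ := by
      rw [hκ, r1]
      field_simp
    rw [this]
    rw [r1] at r3
    linear_combination (1 / 2 : ℂ) * r2 + (1 / 2 : ℂ) * r3 + (1 / 2 : ℂ) * r4
  -- Both coefficient vectors are annihilated by the columns at `x₀`.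
  have k1 : ∀ i, ∑ j : Fin (m + 1), c j * (twistCol l p j i).eval x₀ = 0 := by
    intro i
    have := congrArg (eval x₀) (sum_twistCol_mul_waveCoeff l p i)
    rw [eval_mul, ← hD, h0, zero_mul, eval_finsetSum] at this
    rw [← this]
    exact Finset.sum_congr rfl fun j _ => by rw [eval_mul, hc, mul_comm]
  have k2 : ∀ i, ∑ j : Fin (m + 1), e j * (twistCol l p j i).eval x₀ = 0 := by
    intro i
    rw [hsum fun k => (twistCol l p k i).eval x₀]
    have := congrArg (fun r => (derivative r).eval x₀) (sum_twistCol_mul_waveCoeff l p i)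
    simp only [derivative_sum, derivative_mul, eval_finsetSum, eval_add, eval_mul, hc, hc',
      ← hD, h0, zero_mul, add_zero, Finset.sum_add_distrib] at this
    rw [r1, ← this, sub_eq_zero]
    have h5 : ∀ j : ℕ, (twistCol l p (j + 1) i).eval x₀ =
        (derivative (twistCol l p j i)).eval x₀ + l i * (twistCol l p j i).eval x₀ := by
      intro j
      rw [twistCol_succ, eval_add, eval_mul, eval_C]
    have h6 : ∑ j : Fin (m + 1), c j * (twistCol l p (j + 1) i).eval x₀ =
        ∑ j : Fin (m + 1), (derivative (twistCol l p j i)).eval x₀ * c j := by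
      have : ∑ j : Fin (m + 1), c j * (twistCol l p (j + 1) i).eval x₀ =
          ∑ j : Fin (m + 1), (derivative (twistCol l p j i)).eval x₀ * c j +
          l i * ∑ j : Fin (m + 1), c j * (twistCol l p j i).eval x₀ := by
        rw [Finset.mul_sum, ← Finset.sum_add_distrib]
        refine Finset.sum_congr rfl fun j _ => ?_
        rw [h5]
        ring
      rw [this, k1, mul_zero, add_zero]
    rw [h6, add_comm]
    congr 1
    exact Finset.sum_congr rfl fun j _ => mul_comm _ _
  -- Hence they are proportional, since all columns but the last are independent at `x₀`.
  have hu : ∀ j, e j - κ * c j = 0 := by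
    set B := ((twistMatrix l p).updateCol (Fin.last m) (twistCol l p (m + 1))).map (eval x₀) with hB
    have hdet : B.det ≠ 0 := by
      have : B = (evalRingHom x₀).mapMatrix
        ((twistMatrix l p).updateCol (Fin.last m) (twistCol l p (m + 1))) := rfl
      rw [this, ← RingHom.map_det, coe_evalRingHom]
      have h7 := hc (Fin.last m)
      rw [r1] at h7
      exact h7 ▸ h1
    have h8 : B.mulVec (fun j => e j - κ * c j) = 0 := by
      ext i
      have h9 : ∑ j : Fin (m + 1), (e j - κ * c j) * (twistCol l p j i).eval x₀ = 0 := by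
        simp only [sub_mul, mul_assoc, Finset.sum_sub_distrib, ← Finset.mul_sum, k1, k2]
        simp
      rw [Pi.zero_apply, ← h9]
      change ∑ j, B i j * (e j - κ * c j) = _
      refine Finset.sum_congr rfl fun j _ => ?_
      by_cases hj : j = Fin.last m
      · rw [hj, helast]
        simp
      · rw [hB, Matrix.map_apply, Matrix.updateCol_ne hj]
        exact mul_comm _ _
    exact fun j => congrFun (Matrix.eq_zero_of_mulVec_eq_zero hdet h8) j
  have w1 : (waveNum l p z).eval x₀ = -∑ j : Fin (m + 1), c j * z ^ (j : ℕ) := by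
    rw [waveNum, eval_sub, eval_mul, ← hD, h0, mul_zero, zero_sub, eval_finsetSum]
    congr 1
    refine Finset.sum_congr rfl fun j _ => ?_
    rw [eval_mul, eval_C, hc, mul_comm]
  have w2 : (derivative (waveNum l p z)).eval x₀ =
      z ^ (m + 1) * c (Fin.last m) - ∑ j : Fin (m + 1), c' j * z ^ (j : ℕ) := by
    rw [waveNum, derivative_sub, eval_sub, derivative_C_mul, eval_mul, eval_C, ← hD, r1,
      derivative_sum, eval_finsetSum]
    congr 1
    refine Finset.sum_congr rfl fun j _ => ?_
    rw [derivative_C_mul, eval_mul, eval_C, hc', mul_comm]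
  have w3 := hsum fun k => z ^ k
  have w4 : ∑ j : Fin (m + 1), e j * z ^ (j : ℕ) = κ * ∑ j : Fin (m + 1), c j * z ^ (j : ℕ) := by
    rw [Finset.mul_sum]
    refine Finset.sum_congr rfl fun j _ => ?_
    rw [sub_eq_zero.mp (hu j), mul_assoc]
  have w5 : ∑ j : Fin (m + 1), c j * z ^ ((j : ℕ) + 1) =
      z * ∑ j : Fin (m + 1), c j * z ^ (j : ℕ) := by
    rw [Finset.mul_sum]
    exact Finset.sum_congr rfl fun j _ => by ring
  rw [w4, w5] at w3
  rw [w1, w2]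
  linear_combination w3

end Wave

/-! ### The indicial equation at infinity -/

/-- If a space `U` of polynomials is annihilated by the differential operator `∑ Tₖ ∂ᵏ` with
polynomial coefficients of degree at most `d`, then the first `dim U` coefficients have degree
smaller than `d`. The degrees of the members of `U`, of which there are at least `dim U`, are
roots of the indicial polynomial at infinity. So some `Tₖ` with `k ≥ dim U` contributes to the
indicial polynomial, which bounds the degrees of the others. -/
theorem Polynomial.coeff_eq_zero_of_sum_mul_iterate_derivative {M d : ℕ} {T : ℕ → ℂ[X]}
    (hd : ∀ k, (T k).natDegree ≤ d) (U : Submodule ℂ ℂ[X])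
    (hU : ∀ p ∈ U, ∑ k ∈ Finset.range (M + 1), T k * derivative^[k] p = 0) {k : ℕ}
    (hk : k < Module.finrank ℂ U) (hkM : k ≤ M) : (T k).coeff d = 0 := by
  by_contra hne
  set T' : ℕ → ℂ[X] := fun i => X ^ (M - i) * T i with hT'
  have hTk : T k ≠ 0 := fun h => hne (by rw [h, coeff_zero])
  obtain ⟨i₀, hi₀, hmax⟩ := ((Finset.range (M + 1)).filter fun i => T i ≠ 0).exists_max_image
    (fun i => (T' i).natDegree) ⟨k, by simp [hTk]; omega⟩
  rw [Finset.mem_filter, Finset.mem_range] at hi₀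
  set E := (T' i₀).natDegree with hE
  have hle : ∀ i ∈ Finset.range (M + 1), (T' i).natDegree ≤ E := by
    intro i hi
    by_cases h : T i = 0
    · simp [hT', h]
    · exact hmax i (Finset.mem_filter.mpr ⟨hi, h⟩)
  have hkE : d + (M - k) ≤ E := by
    refine le_trans ?_ (hle k (Finset.mem_range.mpr (by omega)))
    refine le_natDegree_of_ne_zero ?_
    rw [hT', coeff_X_pow_mul]
    exact hne
  set α : ℕ → ℂ := fun i => (T' i).coeff E with hα
  have hα0 : α i₀ ≠ 0 := by
    change (T' i₀).leadingCoeff ≠ 0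
    rw [leadingCoeff_ne_zero]
    exact mul_ne_zero (pow_ne_zero _ X_ne_zero) hi₀.2
  have hαbig : ∀ i ≤ M, k < i → α i = 0 := by
    intro i hi hki
    refine coeff_eq_zero_of_natDegree_lt (lt_of_le_of_lt (b := (M - i) + d) ?_ (by omega))
    exact natDegree_mul_le_of_le (natDegree_X_pow_le _) (hd i)
  set I : ℂ[X] := ∑ i ∈ Finset.range (M + 1), C (α i) * descPochhammer ℂ i with hI
  have hIdeg : I.natDegree ≤ k := by
    refine natDegree_sum_le_of_forall_le _ _ fun i hi => ?_
    rw [Finset.mem_range] at hi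
    by_cases hik : i ≤ k
    · exact (natDegree_C_mul_le _ _).trans (by rwa [descPochhammer_natDegree])
    · rw [hαbig i (by omega) (by omega)]
      simp
  have hIeval : ∀ s : ℕ, I.eval (s : ℂ) =
      ∑ i ∈ Finset.range (M + 1), α i * (s.descFactorial i : ℂ) := by
    intro s
    rw [hI, eval_finsetSum]
    refine Finset.sum_congr rfl fun i _ => ?_
    rw [eval_mul, eval_C, descPochhammer_eval_eq_descFactorial]
  have hI0 : I ≠ 0 := by
    -- Evaluate at the least index with a nonzero coefficient.
    classical
    have hex : ∃ i, α i ≠ 0 := ⟨i₀, hα0⟩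
    set i₁ := Nat.find hex with hi₁
    have h1 : α i₁ ≠ 0 := Nat.find_spec hex
    have h2 : i₁ ≤ i₀ := Nat.find_min' hex hα0
    intro h
    have h3 := hIeval i₁
    rw [h, eval_zero, Finset.sum_eq_single i₁] at h3
    · rw [Nat.descFactorial_self] at h3
      exact mul_ne_zero h1 (Nat.cast_ne_zero.mpr (Nat.factorial_ne_zero _)) h3.symm
    · intro i _ hi
      rcases lt_or_gt_of_ne hi with hi | hi
      · rw [not_not.mp (Nat.find_min hex hi), zero_mul]
      · rw [Nat.descFactorial_eq_zero_iff_lt.mpr hi, Nat.cast_zero, mul_zero]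
    · intro hi
      exact absurd (Finset.mem_range.mpr (by omega)) hi
  have hroot : ∀ p ∈ U, p ≠ 0 → I.eval (p.natDegree : ℂ) = 0 := by
    intro p hp hp0
    set s := p.natDegree with hs
    have h1 : ∑ i ∈ Finset.range (M + 1), T' i * (X ^ i * derivative^[i] p) = 0 := by
      rw [← mul_zero (X ^ M : ℂ[X]), ← hU p hp, Finset.mul_sum]
      refine Finset.sum_congr rfl fun i hi => ?_
      rw [Finset.mem_range] at hi
      have e : (X : ℂ[X]) ^ M = X ^ (M - i) * X ^ i := by
        rw [← pow_add, Nat.sub_add_cancel (by omega)]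
      rw [e]
      simp only [hT']
      ring
    have h2 := congrArg (fun r => r.coeff (E + s)) h1
    simp only [finsetSum_coeff, coeff_zero] at h2
    refine (mul_eq_zero.mp (?_ : I.eval (s : ℂ) * p.leadingCoeff = 0)).resolve_right
      (leadingCoeff_ne_zero.mpr hp0)
    rw [hIeval, Finset.sum_mul, ← h2]
    refine Finset.sum_congr rfl fun i hi => ?_
    by_cases his : i ≤ s
    · rw [coeff_mul_add_eq_of_natDegree_le (hle i hi)]
      · have : (X ^ i * derivative^[i] p).coeff s = (s.descFactorial i : ℂ) * p.leadingCoeff := by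
          conv_lhs => rw [show s = (s - i) + i by omega]
          rw [coeff_X_pow_mul, coeff_iterate_derivative, show s - i + i = s by omega, nsmul_eq_mul]
          rfl
        rw [this, mul_assoc]
      · refine (natDegree_mul_le_of_le (natDegree_X_pow_le _)
          (natDegree_iterate_derivative p i)).trans ?_
        omega
    · rw [Nat.descFactorial_eq_zero_iff_lt.mpr (by omega),
        iterate_derivative_eq_zero (by omega)]
      simp
  set S : Finset ℕ := I.roots.toFinset.preimage (fun s : ℕ => (s : ℂ))
    (Nat.cast_injective.injOn) with hS
  have hcard : S.card ≤ k := by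
    refine le_trans ?_ ((Multiset.toFinset_card_le _).trans ((card_roots' I).trans hIdeg))
    exact Finset.card_le_card_of_injOn (fun s : ℕ => (s : ℂ))
      (fun s hs => Finset.mem_preimage.mp hs) Nat.cast_injective.injOn
  let φ : U →ₗ[ℂ] (S → ℂ) := (LinearMap.pi fun s : S => lcoeff ℂ (s : ℕ)).comp U.subtype
  have hφ : Function.Injective φ := by
    rw [← LinearMap.ker_eq_bot, LinearMap.ker_eq_bot']
    rintro ⟨p, hp⟩ h
    by_contra hp0
    have hp0' : p ≠ 0 := fun h => hp0 (by simp [h])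
    have hmem : p.natDegree ∈ S := by
      rw [hS, Finset.mem_preimage, Multiset.mem_toFinset, mem_roots hI0]
      exact hroot p hp hp0'
    exact hp0' (leadingCoeff_eq_zero.mp (congrFun h ⟨_, hmem⟩))
  have := LinearMap.finrank_le_finrank_of_injective hφ
  rw [Module.finrank_fintype_fun_eq_card, Fintype.card_coe] at this
  omega

theorem twistDeriv_pow_apply (a : ℂ) (p : ℂ[X]) (j : ℕ) :
    (twistDeriv a ^ j) p =
      ∑ k ∈ Finset.range (j + 1), C ((j.choose k : ℂ) * a ^ (j - k)) * derivative^[k] p := by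
  have h : Commute (derivative : Module.End ℂ ℂ[X]) (a • 1) :=
    (Commute.one_right _).smul_right a
  have e : twistDeriv a = (derivative : Module.End ℂ ℂ[X]) + a • 1 := rfl
  rw [e, h.add_pow, LinearMap.sum_apply]
  refine Finset.sum_congr rfl fun k _ => ?_
  have e2 : ((a • 1 : Module.End ℂ ℂ[X]) ^ (j - k) * (j.choose k : Module.End ℂ ℂ[X])) p =
      ((j.choose k : ℂ) * a ^ (j - k)) • p := by
    rw [_root_.smul_pow, one_pow, smul_one_mul, LinearMap.smul_apply, Module.End.natCast_apply,
      ← Nat.cast_smul_eq_nsmul ℂ, smul_smul, mul_comm]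
  rw [mul_assoc, Module.End.mul_apply, e2, map_smul, Module.End.pow_apply, smul_eq_C_mul]

theorem prod_X_sub_C_dvd_of_sum_mul_twistDeriv {M d : ℕ} {l : Fin M → ℂ} {p : Fin M → ℂ[X]}
    (hp : ∀ a, LinearIndependent ℂ fun i : {i // l i = a} => p i) {K : ℕ → ℂ[X]}
    (hd : ∀ j, (K j).natDegree ≤ d)
    (hK : ∀ i, ∑ j ∈ Finset.range (M + 1), K j * (twistDeriv (l i) ^ j) (p i) = 0) :
    ∏ i, (X - C (l i)) ∣ ∑ j ∈ Finset.range (M + 1), monomial j ((K j).coeff d) := by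
  set β : ℂ[X] := ∑ j ∈ Finset.range (M + 1), monomial j ((K j).coeff d) with hβ
  by_cases hβ0 : β = 0
  · rw [hβ0]; exact dvd_zero _
  have key : ∀ a, (X - C a) ^ (Fintype.card {i // l i = a}) ∣ β := by
    intro a
    rw [X_sub_C_pow_dvd_iff, X_pow_dvd_iff]
    intro k hk
    rw [← taylor_apply, taylor_coeff]
    set T : ℕ → ℂ[X] :=
      fun k => ∑ j ∈ Finset.range (M + 1), C ((j.choose k : ℂ) * a ^ (j - k)) * K j with hT
    have hkM : k ≤ M := by
      have := Fintype.card_subtype_le fun i => l i = a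
      rw [Fintype.card_fin] at this
      omega
    have h1 : (T k).coeff d = 0 := by
      refine coeff_eq_zero_of_sum_mul_iterate_derivative (M := M) (fun k => ?_)
        (Submodule.span ℂ (Set.range fun i : {i // l i = a} => p i)) (fun r hr => ?_)
        (by rwa [finrank_span_eq_card (hp a)]) hkM
      · exact natDegree_sum_le_of_forall_le _ _ fun j _ =>
          (natDegree_C_mul_le _ _).trans (hd j)
      · have h2 : ∀ r : ℂ[X], ∑ k ∈ Finset.range (M + 1), T k * derivative^[k] r =
            ∑ j ∈ Finset.range (M + 1), K j * (twistDeriv a ^ j) r := by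
          intro r
          simp only [hT, Finset.sum_mul]
          rw [Finset.sum_comm]
          refine Finset.sum_congr rfl fun j hj => ?_
          rw [Finset.mem_range] at hj
          rw [twistDeriv_pow_apply, Finset.mul_sum]
          symm
          refine (Finset.sum_subset_zero_on_sdiff (Finset.range_mono (by omega)) ?_ ?_)
          · intro i hi
            simp only [Finset.mem_sdiff, Finset.mem_range, not_lt] at hi
            rw [Nat.choose_eq_zero_of_lt (by omega)]
            simp
          · intro i _
            ring
        rw [h2]
        induction hr using Submodule.span_induction with
        | mem r hr =>
          obtain ⟨⟨i, hi⟩, rfl⟩ := hr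
          have h3 := hK i
          rw [hi] at h3
          exact h3
        | zero => simp
        | add r s _ _ hr hs =>
          simp only [map_add, mul_add, Finset.sum_add_distrib, hr, hs, add_zero]
        | smul c r _ hr =>
          simp only [map_smul, mul_smul_comm, ← Finset.smul_sum, hr, smul_zero]
    rw [← h1, hT, hβ, map_sum, eval_finsetSum, finsetSum_coeff]
    refine Finset.sum_congr rfl fun j _ => ?_
    rw [hasseDeriv_monomial, eval_monomial, coeff_C_mul]
    ring
  have hprod : ∏ i, (X - C (l i)) =
      ((Finset.univ.val.map l).map fun a => X - C a).prod := by
    rw [Multiset.map_map]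
    rfl
  classical
  rw [hprod, Multiset.prod_X_sub_C_dvd_iff_le_roots hβ0, Multiset.le_iff_count]
  intro a
  rw [count_roots, le_rootMultiplicity_iff hβ0, Multiset.count_map]
  convert key a using 2
  rw [Fintype.card_subtype]
  simp only [eq_comm (a := a)]
  rfl

/-! ### The top degree of the wave function in `x` -/

theorem waveNum_eq_sum {M : ℕ} (l : Fin M → ℂ) (p : Fin M → ℂ[X]) (z : ℂ) (K : ℕ → ℂ[X])
    (hK : ∀ j : Fin M, K j = -waveCoeff l p j) (hKM : K M = (twistMatrix l p).det) :
    waveNum l p z = ∑ j ∈ Finset.range (M + 1), C (z ^ j) * K j := by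
  rw [Finset.sum_range_succ, Finset.sum_range, hKM, waveNum, sub_eq_neg_add,
    ← Finset.sum_neg_distrib]
  simp only [hK, mul_neg]

/-- In `x` the numerator of the wave function has the degree of the Wronskian, and its top
coefficient is that of the Wronskian times `∏ (z - lᵢ)`: in the bispectral gauge
`ψ(x, z)e^{-xz} → 1` as `x → ∞`. -/
theorem natDegree_waveNum_le_and_coeff {M : ℕ} {l : Fin M → ℂ} {p : Fin M → ℂ[X]}
    (hp : ∀ a, LinearIndependent ℂ fun i : {i // l i = a} => p i)
(z : ℂ) :
    (waveNum l p z).natDegree ≤ (twistMatrix l p).det.natDegree ∧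
    (waveNum l p z).coeff (twistMatrix l p).det.natDegree =
      (twistMatrix l p).det.leadingCoeff * ∏ i, (z - l i) := by
  set D := (twistMatrix l p).det with hDdef
  set n := D.natDegree with hn
  obtain ⟨K, hK, hKM, hKbig⟩ : ∃ K : ℕ → ℂ[X], (∀ j : Fin M, K j = -waveCoeff l p j) ∧
      K M = D ∧ ∀ j, M < j → K j = 0 :=
    ⟨fun j => if h : j < M then -waveCoeff l p ⟨j, h⟩ else if j = M then D else 0,
      fun j => by simp, by simp, fun j hj => by simp [hj.not_gt, hj.ne']⟩
  have hrel : ∀ i, ∑ j ∈ Finset.range (M + 1), K j * (twistDeriv (l i) ^ j) (p i) = 0 := by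
    intro i
    have h := sum_twistCol_mul_waveCoeff l p i
    rw [Finset.sum_range_succ, Finset.sum_range, hKM]
    simp only [hK, neg_mul, Finset.sum_neg_distrib]
    rw [neg_add_eq_zero]
    refine Eq.trans (Finset.sum_congr rfl fun j _ => mul_comm _ _) h
  have hmon : (∏ i, (X - C (l i))).Monic := monic_prod_of_monic _ _ fun i _ => monic_X_sub_C _
  have hdegq : (∏ i, (X - C (l i))).natDegree = M := by
    rw [natDegree_prod_of_monic _ _ fun i _ => monic_X_sub_C _]
    simp
  have hβdeg : ∀ d, (∑ j ∈ Finset.range (M + 1), monomial j ((K j).coeff d)).natDegree ≤ M := by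
    intro d
    refine natDegree_sum_le_of_forall_le _ _ fun j hj => (natDegree_monomial_le _).trans ?_
    rw [Finset.mem_range] at hj
    omega
  have hβcoeff : ∀ d j, (∑ j ∈ Finset.range (M + 1), monomial j ((K j).coeff d)).coeff j =
      (K j).coeff d := by
    intro d j
    rw [finsetSum_coeff]
    simp only [coeff_monomial]
    rw [Finset.sum_ite_eq']
    split_ifs with h
    · rfl
    · rw [hKbig j (by simpa using h), coeff_zero]
  -- The largest degree of a coefficient is attained by the Wronskian.
  have hdeg : ∀ j, (K j).natDegree ≤ n := by
    obtain ⟨j₁, hj₁, hmax⟩ := (Finset.range (M + 1)).exists_max_image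
      (fun j => (K j).natDegree) ⟨0, by simp⟩
    have hmax' : ∀ j, (K j).natDegree ≤ (K j₁).natDegree := by
      intro j
      by_cases hj : j < M + 1
      · exact hmax j (Finset.mem_range.mpr hj)
      · rw [hKbig j (by omega)]
        simp
    suffices (K j₁).natDegree ≤ n from fun j => (hmax' j).trans this
    by_contra hlt
    push Not at hlt
    set d := (K j₁).natDegree with hd
    have hdvd := prod_X_sub_C_dvd_of_sum_mul_twistDeriv hp hmax' hrel
    have hj0 : K j₁ ≠ 0 := fun h => by
      rw [hd, h, natDegree_zero] at hlt
      omega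
    have hβ0 : (∑ j ∈ Finset.range (M + 1), monomial j ((K j).coeff d)) ≠ 0 := by
      intro h
      have := hβcoeff d j₁
      rw [h, coeff_zero] at this
      exact hj0 (leadingCoeff_eq_zero.mp this.symm)
    have h1 := natDegree_le_of_dvd hdvd hβ0
    rw [hdegq] at h1
    refine hβ0 (leadingCoeff_eq_zero.mp ?_)
    rw [leadingCoeff, le_antisymm (hβdeg d) h1, hβcoeff, hKM]
    exact coeff_eq_zero_of_natDegree_lt hlt
  have hβ : (∑ j ∈ Finset.range (M + 1), monomial j ((K j).coeff n)) =
      C D.leadingCoeff * ∏ i, (X - C (l i)) := by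
    obtain ⟨r, hr⟩ := prod_X_sub_C_dvd_of_sum_mul_twistDeriv hp hdeg hrel
    have hr0 : r.natDegree = 0 := by
      have h1 := hβdeg n
      by_cases h : r = 0
      · simp [h]
      · rw [hr, hmon.natDegree_mul' h, hdegq] at h1
        omega
    obtain ⟨a, rfl⟩ := natDegree_eq_zero.mp hr0
    have h1 := hβcoeff n M
    rw [hr, hKM, mul_comm, coeff_C_mul] at h1
    have h2 : (∏ i, (X - C (l i))).coeff M = 1 := by
      have h3 := hmon.coeff_natDegree
      rwa [hdegq] at h3
    rw [h2, mul_one] at h1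
    rw [hr, h1, mul_comm]
    rfl
  rw [waveNum_eq_sum l p z K hK hKM]
  refine ⟨natDegree_sum_le_of_forall_le _ _ fun j _ =>
    (natDegree_C_mul_le _ _).trans (hdeg j), ?_⟩
  have h1 := congrArg (eval z) hβ
  rw [eval_mul, eval_C, eval_prod] at h1
  simp only [eval_sub, eval_X, eval_C] at h1
  rw [← h1, finsetSum_coeff, eval_finsetSum]
  refine Finset.sum_congr rfl fun j _ => ?_
  rw [coeff_C_mul, eval_monomial, mul_comm]

/-- At fixed `x` the numerator of the wave function is, as a polynomial in `z`, the Wronskian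
times a monic polynomial of degree `M`. -/
theorem eval_waveNum {M : ℕ} (l : Fin M → ℂ) (p : Fin M → ℂ[X]) {x : ℂ}
    (hx : (twistMatrix l p).det.eval x ≠ 0) (z : ℂ) :
    (X ^ M - ∑ j : Fin M, C ((waveCoeff l p j).eval x / (twistMatrix l p).det.eval x) *
      X ^ (j : ℕ)).eval z = (waveNum l p z).eval x / (twistMatrix l p).det.eval x := by
  simp only [waveNum, eval_sub, eval_mul, eval_finsetSum, eval_C, eval_pow, eval_X]
  rw [sub_div, mul_div_cancel_right₀ _ hx, Finset.sum_div]
  congr 1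
  exact Finset.sum_congr rfl fun j _ => by ring

/-! ### The tau function -/

theorem Module.Basis.linearIndependent_coe {ι V : Type*} [AddCommGroup V] [Module ℂ V]
    {S : Submodule ℂ V} (b : Module.Basis ι ℂ S) : LinearIndependent ℂ fun i => (b i : V) :=
  b.linearIndependent.map' S.subtype (Submodule.ker_subtype _)

theorem Module.Basis.det_toMatrix_ne_zero {ι V : Type*} [Fintype ι] [DecidableEq ι]
    [AddCommGroup V] [Module ℂ V] (b b' : Module.Basis ι ℂ V) : (b.toMatrix b').det ≠ 0 := by
  rw [← Module.Basis.det_apply]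
  exact (b.isUnit_det b').ne_zero

namespace Gr1Star

variable (P : Gr1Star) {l : Fin P.dim → ℂ} {b : Module.Basis (Fin P.dim) ℂ P.space}
  {p : Fin P.dim → ℂ[X]}

theorem linearIndependent_of_ofPoly_eq (hp : ∀ i, Cond.ofPoly (l i) (p i) = b i) (a : ℂ) :
    LinearIndependent ℂ fun i : {i // l i = a} => p i := by
  have h1 : LinearIndependent ℂ fun i => (b i : Cond) := b.linearIndependent_coe
  have h2 : LinearIndependent ℂ fun i : {i // l i = a} => (b i : Cond) :=
    h1.comp _ Subtype.val_injective
  have h3 : (Cond.ofPoly a ∘ fun i : {i // l i = a} => p i) =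
      fun i : {i // l i = a} => (b i : Cond) := by
    funext i
    rw [Function.comp_apply, ← hp, i.2]
  refine LinearIndependent.of_comp (Cond.ofPoly a) ?_
  rw [h3]
  exact h2

/-- The matrix of `tau` formed with an arbitrary basis. -/
noncomputable def basisMatrix (b : Module.Basis (Fin P.dim) ℂ P.space) (s t : ℂ) :
    Matrix (Fin P.dim) (Fin P.dim) ℂ :=
  Matrix.of fun i j => Cond.app (b i : Cond) fun z => z ^ (j : ℕ) * Complex.exp (s * z + t * z ^ 2)

theorem exists_det_tauMatrix_eq (b : Module.Basis (Fin P.dim) ℂ P.space) :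
    ∃ κ : ℂ, κ ≠ 0 ∧ ∀ s t, (P.tauMatrix s t).det = κ * (P.basisMatrix b s t).det := by
  refine ⟨(b.toMatrix (Module.finBasis ℂ P.space)).transpose.det, ?_, fun s t => ?_⟩
  · rw [Matrix.det_transpose]
    exact Module.Basis.det_toMatrix_ne_zero (V := P.space) b (Module.finBasis ℂ P.space)
  · rw [← Matrix.det_mul]
    congr 1
    ext i j
    simp only [tauMatrix, Matrix.of_apply, Matrix.mul_apply, Matrix.transpose_apply,
      Module.Basis.toMatrix_apply, basisMatrix]
    have h := b.sum_repr (Module.finBasis ℂ P.space i)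
    conv_lhs => rw [← h, ← Cond.appLin_apply]
    simp only [Submodule.coe_sum, Submodule.coe_smul, map_sum, map_smul, smul_eq_mul]
    rfl

theorem basisMatrix_zero (hp : ∀ i, Cond.ofPoly (l i) (p i) = b i) (s : ℂ) :
    P.basisMatrix b s 0 = Matrix.of fun i j =>
      Complex.exp (l i * s) * ((twistMatrix l p).map (eval s)) i j := by
  ext i j
  simp only [basisMatrix, Matrix.of_apply, ← hp, Cond.ofPoly_app_pow_mul_exp]
  rfl

/-- The tau function at `t = 0` is, up to a constant, the Wronskian without its exponential
factor. -/
theorem exists_tau_zero_eq (hq : P.q = ∏ i, (X - C (l i)))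
    (hp : ∀ i, Cond.ofPoly (l i) (p i) = b i) :
    ∃ κ : ℂ, κ ≠ 0 ∧ ∀ s, P.tau s 0 = κ * (twistMatrix l p).det.eval s := by
  obtain ⟨κ, hκ, h⟩ := P.exists_det_tauMatrix_eq b
  refine ⟨κ, hκ, fun s => ?_⟩
  have hroots : P.q.roots = Finset.univ.val.map l := by
    rw [hq, ← roots_multiset_prod_X_sub_C (Finset.univ.val.map l), Multiset.map_map]
    rfl
  rw [tau_eq, h, P.basisMatrix_zero hp, Matrix.det_mul_column, hroots, Multiset.map_map]
  have e : ((Finset.univ.val.map ((fun a => Complex.exp (-(a * s + a ^ 2 * 0))) ∘ l)).prod) =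
      ∏ i, Complex.exp (-(l i * s)) := by
    simp only [Function.comp_def, mul_zero, add_zero]
    rfl
  have e2 : (∏ i, Complex.exp (-(l i * s))) * ∏ i, Complex.exp (l i * s) = 1 := by
    rw [← Finset.prod_mul_distrib]
    refine Finset.prod_eq_one fun i _ => ?_
    rw [← Complex.exp_add, neg_add_cancel, Complex.exp_zero]
  have e3 : ((twistMatrix l p).map (eval s)).det = (twistMatrix l p).det.eval s :=
    ((evalRingHom s).map_det _).symm
  rw [e, e3]
  linear_combination (κ * (twistMatrix l p).det.eval s) * e2

/-- The velocity of a zero of `tau` under the second flow, expressed by determinants. -/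
theorem velocity_condition (hp : ∀ i, Cond.ofPoly (l i) (p i) = b i) {ξ : ℂ → ℂ} {v : ℂ}
    (hξ : HasDerivAt ξ v 0) (h0 : ∀ᶠ t in 𝓝 (0 : ℂ), P.tau (ξ t) t = 0) :
    v * (∑ j : Fin P.dim,
        ((twistMatrix l p).updateCol j (twistCol l p (j + 1))).det).eval (ξ 0) +
      (∑ j : Fin P.dim,
        ((twistMatrix l p).updateCol j (twistCol l p (j + 2))).det).eval (ξ 0) = 0 := by
  obtain ⟨κ, hκ, hdet⟩ := P.exists_det_tauMatrix_eq b
  have hz : (fun t => (P.basisMatrix b (ξ t) t).det) =ᶠ[𝓝 0] fun _ => 0 := by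
    filter_upwards [h0] with t ht
    rw [tau_eq, hdet] at ht
    exact ((mul_eq_zero.mp ((mul_eq_zero.mp ht).resolve_left
      (prod_exp_ne_zero _ _)))).resolve_left hκ
  have h1 := HasDerivAt.det (B := fun t => P.basisMatrix b (ξ t) t) (u := 0) fun i j =>
    Cond.hasDerivAt_app_pow_mul_exp hξ (hasDerivAt_id' (0 : ℂ)) (b i : Cond) j
  have h2 := h1.unique ((hasDerivAt_const (0 : ℂ) (0 : ℂ)).congr_of_eventuallyEq hz)
  have key : ∀ (j : Fin P.dim) (k : ℕ), ((P.basisMatrix b (ξ 0) 0).updateCol j fun i =>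
      Cond.app (b i : Cond) fun z => z ^ k * Complex.exp (ξ 0 * z + 0 * z ^ 2)).det =
      (∏ i, Complex.exp (l i * ξ 0)) *
        (((twistMatrix l p).updateCol j (twistCol l p k)).det).eval (ξ 0) := by
    intro j k
    rw [← coe_evalRingHom, RingHom.map_det, ← Matrix.det_mul_column, P.basisMatrix_zero hp]
    congr 1
    ext i r
    by_cases hr : r = j
    · rw [hr, Matrix.updateCol_self, ← hp, Cond.ofPoly_app_pow_mul_exp]
      simp [twistCol]
    · rw [Matrix.updateCol_ne hr, Matrix.of_apply, Matrix.of_apply, RingHom.mapMatrix_apply,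
        Matrix.map_apply, Matrix.map_apply, Matrix.updateCol_ne hr]
      rfl
  have h3 : ∀ j : Fin P.dim, ((P.basisMatrix b (ξ 0) 0).updateCol j fun i =>
      v * (Cond.app (b i : Cond) fun z => z ^ ((j : ℕ) + 1) * Complex.exp (ξ 0 * z + 0 * z ^ 2)) +
      1 * (Cond.app (b i : Cond) fun z =>
        z ^ ((j : ℕ) + 2) * Complex.exp (ξ 0 * z + 0 * z ^ 2))).det =
      (∏ i, Complex.exp (l i * ξ 0)) *
        (v * (((twistMatrix l p).updateCol j (twistCol l p (j + 1))).det).eval (ξ 0) +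
          (((twistMatrix l p).updateCol j (twistCol l p (j + 2))).det).eval (ξ 0)) := by
    intro j
    rw [mul_add, mul_left_comm, ← key, ← key, ← Matrix.det_updateCol_smul,
      ← Matrix.det_updateCol_add]
    congr 2
    funext i
    simp
  rw [Finset.sum_congr rfl fun j _ => h3 j, ← Finset.mul_sum, Finset.sum_add_distrib,
    ← Finset.mul_sum] at h2
  rw [eval_finsetSum, eval_finsetSum]
  exact (mul_eq_zero.mp h2).resolve_left (Finset.prod_ne_zero_iff.mpr fun i _ =>
    Complex.exp_ne_zero _)

theorem app_X_pow_sub_waveCoeff (hp : ∀ i, Cond.ofPoly (l i) (p i) = b i) {x : ℂ}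
    (hx : (twistMatrix l p).det.eval x ≠ 0) {c : Cond} (hc : c ∈ P.space) :
    c.app (fun z => (X ^ P.dim - ∑ j : Fin P.dim,
      C ((waveCoeff l p j).eval x / (twistMatrix l p).det.eval x) * X ^ (j : ℕ)).eval z *
        Complex.exp (x * z)) = 0 := by
  refine P.app_eq_zero_of_basis b (fun i => ?_) hc
  rw [Cond.app_X_pow_sub_sum_mul_exp, ← hp]
  simp only [Cond.ofPoly_app_pow_mul_exp]
  have h := congrArg (eval x) (sum_twistCol_mul_waveCoeff l p i)
  rw [eval_finsetSum, eval_mul] at h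
  simp only [eval_mul, twistCol] at h
  have e : ∑ j : Fin P.dim, (waveCoeff l p j).eval x / (twistMatrix l p).det.eval x *
      (Complex.exp (l i * x) * ((twistDeriv (l i) ^ (j : ℕ)) (p i)).eval x) =
      Complex.exp (l i * x) / (twistMatrix l p).det.eval x *
      ∑ j : Fin P.dim, ((twistDeriv (l i) ^ (j : ℕ)) (p i)).eval x * (waveCoeff l p j).eval x := by
    rw [Finset.mul_sum]
    exact Finset.sum_congr rfl fun j _ => by ring
  rw [e, h]
  field_simp
  ring

end Gr1Star

/-! ### The dual conditions and the bispectral involution -/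

theorem dualCond_app {n : ℕ} (x y : Fin n → ℂ) (i : Fin n) (f : ℂ → ℂ) :
    (dualCond x y i).app f =
      deriv f (x i) + (y i - ∑ j ∈ Finset.univ.erase i, 1 / (x i - x j)) * f (x i) := by
  rw [← Cond.appLin_apply, dualCond, map_add, map_smul, Cond.d, Cond.d, Cond.appLin,
    Finsupp.linearCombination_single, Finsupp.linearCombination_single]
  simp

theorem linearIndependent_dualCond {n : ℕ} {x : Fin n → ℂ} (y : Fin n → ℂ)
    (hx : Function.Injective x) : LinearIndependent ℂ (dualCond x y) := by
  rw [Fintype.linearIndependent_iff]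
  intro g hg k
  have h := DFunLike.congr_fun hg (1, x k)
  rw [Finsupp.finsetSum_apply, Finset.sum_eq_single k] at h
  · simpa [dualCond, Cond.d] using h
  · intro i _ hik
    have : x i ≠ x k := fun h => hik (hx h)
    simp [dualCond, Cond.d, this]
  · simp

/-- At a root of a polynomial with simple roots, `f''/(2f')` is the sum of the inverse distances
to the other roots. -/
theorem eval_derivative_of_eq_prod {n : ℕ} {x : Fin n → ℂ} (hx : Function.Injective x) {k : ℂ}
    (hk : k ≠ 0) (i : Fin n) {D : ℂ[X]} (hD : D = C k * ∏ j, (X - C (x j))) :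
    D.eval (x i) = 0 ∧ (derivative D).eval (x i) ≠ 0 ∧
    (derivative (derivative D)).eval (x i) / (2 * (derivative D).eval (x i)) =
      ∑ j ∈ Finset.univ.erase i, 1 / (x i - x j) := by
  set R := ∏ j ∈ Finset.univ.erase i, (X - C (x j)) with hR
  have hDR : D = C k * ((X - C (x i)) * R) := by
    rw [hD, ← Finset.mul_prod_erase _ _ (Finset.mem_univ i)]
  have hne : ∀ j ∈ Finset.univ.erase i, x i - x j ≠ 0 := fun j hj =>
    sub_ne_zero.mpr fun h => Finset.ne_of_mem_erase hj (hx h).symm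
  have hR0 : R.eval (x i) ≠ 0 := by
    rw [hR, eval_prod]
    refine Finset.prod_ne_zero_iff.mpr fun j hj => ?_
    rw [eval_sub, eval_X, eval_C]
    exact hne j hj
  have hR1 : (derivative R).eval (x i) =
      R.eval (x i) * ∑ j ∈ Finset.univ.erase i, 1 / (x i - x j) := by
    rw [hR, derivative_prod_finset, eval_finsetSum, Finset.mul_sum]
    refine Finset.sum_congr rfl fun j hj => ?_
    rw [← Finset.prod_erase_mul _ _ hj, derivative_X_sub_C]
    simp only [eval_mul, eval_sub, eval_X, eval_C, eval_one]
    have := hne j hj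
    field_simp
  have h1 : (derivative D).eval (x i) = k * R.eval (x i) := by
    rw [hDR]
    simp
  have h2 : (derivative (derivative D)).eval (x i) = k * (2 * (derivative R).eval (x i)) := by
    rw [hDR]
    simp only [derivative_mul, derivative_add, derivative_sub, derivative_X,
      derivative_C, derivative_one, eval_mul, eval_add, eval_sub, eval_X, eval_C,
      eval_one, eval_zero, sub_zero]
    ring
  refine ⟨by rw [hDR]; simp, by rw [h1]; exact mul_ne_zero hk hR0, ?_⟩
  rw [h1, h2, hR1]
  field_simp

theorem mainTheorem3 (P : Gr1Star) (hP : P.IsBispectralRational)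
    {n : ℕ} (x y : Fin n → ℂ) (hx : Function.Injective x) (hxy : P.IsParticleSystem x y) :
    LinearIndependent ℂ (dualCond x y) ∧
    ∃ Q : Gr1Star, Q.space = Submodule.span ℂ (Set.range (dualCond x y)) ∧
      Q.q = ∏ i, (Polynomial.X - Polynomial.C (x i)) ∧
      P.IsBispectralImage Q := by
  have hli := linearIndependent_dualCond y hx
  refine ⟨hli, ?_⟩
  obtain ⟨l, b, hb, hq⟩ := hP
  choose p hp using fun i => Cond.exists_ofPoly_eq (hb i)
  obtain ⟨ξ, hξ0, hξ, hξτ⟩ := hxy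
  obtain ⟨κ, hκ, hτ⟩ := P.exists_tau_zero_eq hq hp
  set D := (twistMatrix l p).det with hD
  have hq'monic : (∏ i, (X - C (x i))).Monic := monic_prod_of_monic _ _ fun i _ => monic_X_sub_C _
  have hq'deg : (∏ i, (X - C (x i))).natDegree = n := by
    rw [natDegree_prod_of_monic _ _ fun i _ => monic_X_sub_C _]
    simp
  -- The Wronskian is a multiple of `∏ (X - xᵢ)`.
  obtain ⟨k, hk, hDk⟩ : ∃ k : ℂ, k ≠ 0 ∧ D = C k * ∏ i, (X - C (x i)) := by
    obtain ⟨k, hk, h⟩ := hξτ.self_of_nhds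
    refine ⟨κ⁻¹ * k, mul_ne_zero (inv_ne_zero hκ) hk, Polynomial.funext fun s => ?_⟩
    have h1 := h s
    rw [hτ] at h1
    simp only [hξ0] at h1
    rw [eval_mul, eval_C, eval_prod]
    simp only [eval_sub, eval_X, eval_C]
    rw [mul_assoc, ← h1, inv_mul_cancel_left₀ hκ]
  have hDdeg : D.natDegree = n := by rw [hDk, natDegree_C_mul hk, hq'deg]
  have hDlead : D.leadingCoeff = k := by
    rw [hDk, leadingCoeff_mul, leadingCoeff_C, hq'monic.leadingCoeff, mul_one]
  have hDeval : ∀ s, D.eval s = k * (∏ i, (X - C (x i))).eval s := fun s => by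
    rw [hDk, eval_mul, eval_C]
  have hqeval : ∀ s, P.q.eval s = ∏ i, (s - l i) := fun s => by
    rw [hq, eval_prod]
    simp
  have hpole : ∀ i z, (derivative (waveNum l p z)).eval (x i) + z * (waveNum l p z).eval (x i) +
      (y i - ∑ j ∈ Finset.univ.erase i, 1 / (x i - x j)) * (waveNum l p z).eval (x i) = 0 := by
    intro i z
    obtain ⟨h0, h1, h2⟩ := eval_derivative_of_eq_prod hx hk i hDk
    rw [← h2]
    refine waveNum_pole_condition l p h0 h1 ?_ z
    rw [← hξ0 i]
    refine P.velocity_condition hp (hξ i) ?_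
    filter_upwards [hξτ] with t ht
    obtain ⟨k', _, h⟩ := ht
    rw [h, Finset.prod_eq_zero (Finset.mem_univ i) (sub_self _), mul_zero]
  have hwave := natDegree_waveNum_le_and_coeff (P.linearIndependent_of_ofPoly_eq hp)
  let Q : Gr1Star :=
    { space := Submodule.span ℂ (Set.range (dualCond x y))
      finite := FiniteDimensional.span_of_finite ℂ (Set.finite_range _)
      q := ∏ i, (X - C (x i))
      monic := hq'monic
      natDegree_eq := by rw [hq'deg, finrank_span_eq_card hli, Fintype.card_fin] }
  have hQq : Q.q = ∏ i, (X - C (x i)) := rfl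
  have hQdim : Q.dim = n := Q.natDegree_eq.symm.trans hq'deg
  -- The quotient that defines `ψ(s, z)` makes no sense at the zeros `z` of `q`. Those at which the
  -- tau function of `Q` does not vanish belong to the domain of the wave function of `Q`; there
  -- `ψ(·, z)` is taken to be that wave function.
  choose! g hgm hgd hgc using fun s (hs : Q.tau s 0 ≠ 0) => Q.exists_monic_app_eq_zero hs
  refine ⟨Q, rfl, rfl, fun s z => if P.q.eval z = 0 then
      (g z).eval s / Q.q.eval s * Complex.exp (z * s) else
      (waveNum l p z).eval s / (D.eval s * P.q.eval z) * Complex.exp (s * z), ?_, ?_⟩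
  · intro s hs
    have hDs : D.eval s ≠ 0 := by
      rw [hτ] at hs
      exact right_ne_zero_of_mul hs
    refine P.wave_of_monic hs (monic_X_pow_sub_sum _) (natDegree_X_pow_sub_sum _)
      (fun c hc => P.app_X_pow_sub_waveCoeff hp hDs hc) fun z hz => ?_
    refine (if_neg hz).trans ?_
    rw [eval_waveNum l p hDs, div_div]
  · intro s hs
    by_cases hqs : P.q.eval s = 0
    · refine Q.wave_of_monic hs (hgm s hs) (hgd s hs) (hgc s hs) fun z _ => ?_
      exact if_pos hqs
    · obtain ⟨hdeg, hcoeff⟩ := hwave s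
      rw [← hD, hDdeg] at hdeg hcoeff
      rw [hDlead, ← hqeval] at hcoeff
      have hks : k * P.q.eval s ≠ 0 := mul_ne_zero hk hqs
      have hG : (C (k * P.q.eval s)⁻¹ * waveNum l p s).coeff n = 1 := by
        rw [coeff_C_mul, hcoeff, inv_mul_cancel₀ hks]
      have hGdeg : (C (k * P.q.eval s)⁻¹ * waveNum l p s).natDegree ≤ n :=
        (natDegree_C_mul_le _ _).trans hdeg
      refine Q.wave_of_monic hs (g := C (k * P.q.eval s)⁻¹ * waveNum l p s)
        (monic_of_natDegree_le_of_coeff_eq_one n hGdeg hG)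
        (hQdim ▸ natDegree_eq_of_le_of_coeff_ne_zero hGdeg (by rw [hG]; exact one_ne_zero))
        (fun c hc => ?_) fun z hz => ?_
      · have hsub : Q.space ≤ LinearMap.ker (Cond.appLin fun z =>
            (C (k * P.q.eval s)⁻¹ * waveNum l p s).eval z * Complex.exp (s * z)) := by
          refine Submodule.span_le.mpr ?_
          rintro _ ⟨i, rfl⟩
          rw [SetLike.mem_coe, LinearMap.mem_ker, Cond.appLin_apply, dualCond_app]
          have hd : HasDerivAt (fun z => (C (k * P.q.eval s)⁻¹ * waveNum l p s).eval z *
              Complex.exp (s * z)) ((derivative (C (k * P.q.eval s)⁻¹ * waveNum l p s)).eval (x i) *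
              Complex.exp (s * x i) + (C (k * P.q.eval s)⁻¹ * waveNum l p s).eval (x i) *
              (Complex.exp (s * x i) * (s * 1))) (x i) :=
            (Polynomial.hasDerivAt _ _).fun_mul ((hasDerivAt_id' (x i)).const_mul s).cexp
          rw [hd.deriv, derivative_C_mul, eval_mul, eval_mul, eval_C]
          linear_combination ((k * P.q.eval s)⁻¹ * Complex.exp (s * x i)) * hpole i s
        exact hsub hc
      · refine (if_neg hqs).trans ?_
        rw [eval_mul, eval_C, hDeval, hQq]
        rw [mul_comm z s]
        congr 1
        field_simp
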